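/- Let $X(t)$, $t\in\mathbb R$, be a measurable, mean-square continuous, real-valued, stationary, zero-mean Gaussian process with covariance $\mathrm{Cov}(X(t),X(t'))=\int_{\mathbb R}e^{iu(t-t')}f(u)\,du$ and spectral density $$f(\lambda)=\frac{h(\lambda)}{|\lambda^2-s_0^2|^{2\alpha}},\qquad s_0>1,\quad \alpha\in(0,1/2),$$ where $h$ is an even, non-negative, bounded, four times continuously differentiable function with $h(0)=1$, $h^{(i)}(0)=0$ for $i=1,2,3,4$, $h>0$ in a neighbourhood of $\pm s_0$, and $\int_{\mathbb R}h(\lambda)(1+|\lambda|)^{-\varepsilon}d\lambda<\infty$ for all $\varepsilon>0$. Let $\psi\in L_1(\mathbb R)$ be real-valued with $\widehat\psi(\lambda)=\int_{\mathbb R}e^{-i\lambda t}\psi(t)\,dt$, let $0<B<A$, and suppose that $\mathrm{supp}\,\widehat\psi\subseteq\{\xi: B\le|\xi|\le A\}$ and that $\widehat\psi$ has bounded variation on $[-A,A]$. Let $(a_j)_{j\in\mathbb N}$ be a strictly increasing unbounded sequence of positive reals, $(m_j)_{j\in\mathbb N}$ an increasing unbounded sequence of positive integers, $(\gamma_j)_{j\in\mathbb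 N}$ a sequence of positive reals, and $(b_{jk})_{(j,k)\in\mathbb N\times\mathbb Z}$ an array of reals such that $b_{jk}-b_{jl}=\gamma_j(k-l)$ for all $j\in\mathbb N$ and $k,l\in\mathbb Z$. Suppose that, as $j\to+\infty$, $$\frac{a_j}{\gamma_j}\to c\in(0,+\infty),\qquad m_j^2a_j^8\Big(\frac{\gamma_j}{a_j}-\frac1c\Big)\to0,\qquad m_ja_j^{-4}\to0,$$ and that for some $j_0$ one has $a_{j+1}/a_j\ge A/B$ for all $j\ge j_0$. Define $$\delta_{jk}=\frac1{\sqrt{a_j}}\int_{\mathbb R}\psi\Big(\frac{t-b_{jk}}{a_j}\Big)X(t)\,dt,\qquad \overline\delta_j^{(2,n)}=\frac1n\sum_{k=1}^n\delta_{jk}^2,\qquad M_j=\left[\frac{m_j}{(a_{j+1}^{-2}-a_{j+2}^{-2})^2}\right]$$ with $[\cdot]$ the integer part, $$\overline Y_j=\sqrt{m_j}\Big(\overline\delta_j^{(2,m_j)}-s_0^{-4\alpha}\int_{\mathbb R}|\widehat\psi(\eta)|^2d\eta\Big),$$ $$\overline Z_j=\sqrt{m_j}\bigg(\frac{\overline\delta_{j+1}^{(2,M_j)}-\overline\delta_{j+2}^{(2,M_j)}}{a_{j+1}^{-2}-a_{j+2}^{-2}}-2\alpha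 s_0^{-4\alpha-2}\int_{\mathbb R}\eta^2|\widehat\psi(\eta)|^2d\eta\bigg),$$ (where $\overline\delta_j^{(2,0)}:=0$; this concerns at most finitely many $j$) and $$\mathcal V_1=4c\pi s_0^{-8\alpha}\int_{-c\pi}^{c\pi}\Big|\sum_{n\in\mathbb Z}\big|\widehat\psi(\eta+2nc\pi)\big|^2\Big|^2d\eta .$$ Then, as $j\to+\infty$, the random vectors $(\overline Y_j,\overline Z_j)$ converge in distribution to the bivariate centred Gaussian distribution with covariance matrix $\begin{pmatrix}\mathcal V_1&0\\0&2\mathcal V_1\end{pmatrix}$. In particular, the two components of the limit are independent, i.e. $\overline Y_j$ and $\overline Z_j$ are asymptotically independent. -/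

import Mathlib

open MeasureTheory ProbabilityTheory Filter Topology

noncomputable section

namespace CyclicLongMemory

/-- The semiparametric spectral density `h(λ) / |λ² - s₀²|^(2α)`. -/
def spectralDensity (h : ℝ → ℝ) (s₀ α : ℝ) (l : ℝ) : ℝ :=
  h l / |l ^ 2 - s₀ ^ 2| ^ (2 * α)

/-- The assumptions on the parameters `s₀`, `α` and the nuisance function `h`. -/
structure IsSemiparametricModel (h : ℝ → ℝ) (s₀ α : ℝ) : Prop where
  one_lt_s₀ : 1 < s₀
  α_pos : 0 < α
  α_lt_half : α < 1 / 2
  even : ∀ x, h (-x) = h x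
  nonneg : ∀ x, 0 ≤ h x
  bounded : ∃ C, ∀ x, h x ≤ C
  contDiff : ContDiff ℝ 4 h
  deriv_zero : ∀ i ∈ Finset.Icc 1 4, iteratedDeriv i h 0 = 0
  at_zero : h 0 = 1
  pos_near : ∀ᶠ x in 𝓝 s₀, 0 < h x
  pos_near_neg : ∀ᶠ x in 𝓝 (-s₀), 0 < h x
  integrable : ∀ ε : ℝ, 0 < ε → Integrable (fun x : ℝ => h x / (1 + |x|) ^ ε)

/-- `X` is a (jointly) measurable, mean-square continuous, real-valued, zero-mean stationary
Gaussian process on `(Ω, P)` with spectral density `f`, that is,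
`Cov(X(t), X(s)) = ∫ e^{iu(t-s)} f(u) du`. -/
structure IsStationaryGaussian {Ω : Type*} [MeasurableSpace Ω] (P : Measure Ω)
    (X : ℝ → Ω → ℝ) (f : ℝ → ℝ) : Prop where
  measurable : Measurable (Function.uncurry X)
  gaussian : IsGaussianProcess X P
  centred : ∀ t, ∫ ω, X t ω ∂P = 0
  stationary : ∀ r, P.map (fun ω t => X (t + r) ω) = P.map (fun ω t => X t ω)
  msContinuous : ∀ t, Tendsto (fun s => ∫ ω, (X s ω - X t ω) ^ 2 ∂P) (𝓝 t) (𝓝 0)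
  density_nonneg : ∀ u, 0 ≤ f u
  density_integrable : Integrable f
  covariance_eq : ∀ t s, ((cov[X t, X s; P] : ℝ) : ℂ) =
    ∫ u : ℝ, Complex.exp (Complex.I * u * (t - s)) * (f u : ℂ)

/-- The Fourier transform `ψ̂(λ) = ∫ e^{-iλt} ψ(t) dt`. -/
def hat (ψ : ℝ → ℝ) (l : ℝ) : ℂ :=
  ∫ t : ℝ, Complex.exp (-Complex.I * l * t) * (ψ t : ℂ)

/-- The filter transform `δ_{jk} = a_j^{-1/2} ∫ ψ((t - b_{jk}) / a_j) X(t) dt`. -/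
def filterTransform {Ω : Type*} (ψ : ℝ → ℝ) (X : ℝ → Ω → ℝ) (a : ℕ → ℝ) (b : ℕ → ℤ → ℝ)
    (j : ℕ) (k : ℤ) (ω : Ω) : ℝ :=
  1 / √(a j) * ∫ t : ℝ, ψ ((t - b j k) / a j) * X t ω

/-- `(1 / n) ∑_{k=1}^n δ_{jk}²`. -/
def meanSquare {Ω : Type*} (ψ : ℝ → ℝ) (X : ℝ → Ω → ℝ) (a : ℕ → ℝ) (b : ℕ → ℤ → ℝ)
    (j n : ℕ) (ω : Ω) : ℝ :=
  1 / (n : ℝ) * ∑ k ∈ Finset.Icc 1 n, filterTransform ψ X a b j (k : ℤ) ω ^ 2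

/-- `a_{j+1}^{-2} - a_{j+2}^{-2}`. -/
def scaleGap (a : ℕ → ℝ) (j : ℕ) : ℝ :=
  (a (j + 1) ^ 2)⁻¹ - (a (j + 2) ^ 2)⁻¹

/-- `M_j`, the integer part of `m_j / (a_{j+1}^{-2} - a_{j+2}^{-2})²`. -/
def bigM (a : ℕ → ℝ) (m : ℕ → ℕ) (j : ℕ) : ℕ :=
  ⌊(m j : ℝ) / scaleGap a j ^ 2⌋₊

/-- The normalized increment of the mean squares of levels `j + 1` and `j + 2`, both computed
from `M_j` coefficients. -/
def incrementStat {Ω : Type*} (ψ : ℝ → ℝ) (X : ℝ → Ω → ℝ) (a : ℕ → ℝ) (b : ℕ → ℤ → ℝ)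
    (m : ℕ → ℕ) (j : ℕ) (ω : Ω) : ℝ :=
  (meanSquare ψ X a b (j + 1) (bigM a m j) ω - meanSquare ψ X a b (j + 2) (bigM a m j) ω) /
    scaleGap a j

/-- The first centred and scaled statistic. -/
def Ybar {Ω : Type*} (ψ : ℝ → ℝ) (X : ℝ → Ω → ℝ) (a : ℕ → ℝ) (b : ℕ → ℤ → ℝ)
    (m : ℕ → ℕ) (s₀ α : ℝ) (j : ℕ) (ω : Ω) : ℝ :=
  √(m j : ℝ) * (meanSquare ψ X a b j (m j) ω - s₀ ^ (-4 * α) * ∫ η : ℝ, ‖hat ψ η‖ ^ 2)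

/-- The second centred and scaled statistic. -/
def Zbar {Ω : Type*} (ψ : ℝ → ℝ) (X : ℝ → Ω → ℝ) (a : ℕ → ℝ) (b : ℕ → ℤ → ℝ)
    (m : ℕ → ℕ) (s₀ α : ℝ) (j : ℕ) (ω : Ω) : ℝ :=
  √(m j : ℝ) * (incrementStat ψ X a b m j ω -
    2 * α * s₀ ^ (-4 * α - 2) * ∫ η : ℝ, η ^ 2 * ‖hat ψ η‖ ^ 2)

/-- The asymptotic variance
`4cπ s₀^{-8α} ∫_{-cπ}^{cπ} |∑_{n ∈ ℤ} |ψ̂(η + 2ncπ)|²|² dη`. -/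
def asymptoticVariance (ψ : ℝ → ℝ) (c s₀ α : ℝ) : ℝ :=
  4 * c * Real.pi * s₀ ^ (-8 * α) *
    ∫ η in (-(c * Real.pi))..(c * Real.pi),
      (∑' n : ℤ, ‖hat ψ (η + 2 * n * c * Real.pi)‖ ^ 2) ^ 2

/-- The covariance matrix `diag(V, 2V)`. -/
def limitCovariance (V : ℝ) : Matrix (Fin 2) (Fin 2) ℝ :=
  !![V, 0; 0, 2 * V]

end CyclicLongMemory

end

/-!
Along any direction `(u, v)` the combination `u Y_j + v Z_j` is, up to a deterministic bias, a
centred diagonal quadratic form in a Gaussian vector: the coefficients `δ_{jk}` of level `j`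
followed by those of the levels `j + 1` and `j + 2` (`linearCombination_eq`). These coefficients are
jointly Gaussian (`IsStationaryGaussian.map_integral`). As consecutive scales grow at least by the
factor `A / B`, the three levels look at disjoint frequency bands, so they are uncorrelated
(`weightCov_cross_level`); within a level the covariances depend on the lag only
(`weightCov_same_level`). The two statistics thus come from independent blocks, which is why the
limit covariance is diagonal, and the increment adds the contributions of two levels, which gives
the factor `2`.

A diagonal quadratic form with weights `w` in a Gaussian vector with covariance `R` has the law of
`∑ μᵢ gᵢ²`, where the `gᵢ` are independent standard Gaussian and the `μᵢ` are the eigenvalues of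
`√R W √R`, `W` being the diagonal matrix of the weights. After centring it is asymptotically
Gaussian once `∑ μᵢ²` converges and `max |μᵢ|` tends to zero (`tendsto_charFun_gaussian_quadForm`).
By Gershgorin's theorem the maximum is at most the largest row sum of `|R W|`. Bounded variation of the
transform of the filter makes the covariance at lag `k` of order `1 / (1 + |k|)`, uniformly in the level
(`exists_levelCov_bound`). With `n` coefficients and weights of order `n^{-1/2}` the row sums are
then `O(log n / √n)`, and the square summable bound allows a passage to the limit under the sum over
lags (`tendsto_mean_double_sum`): `∑ μᵢ²` tends to a multiple of the sum of the squared limit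
covariances. The latter are, up to a constant, the Fourier coefficients of a periodization of the
squared modulus of the transform, and Parseval's identity evaluates the sum
(`hasSum_sq_integral_cos`).

The bias is governed by the behaviour of the spectral density at frequency zero, where it equals
`s₀^{-4α} + 2α s₀^{-4α-2} λ² + O(λ⁴)` (`spectralDensity_isBigO`). The variance of level `j`
therefore has an expansion in `a_j^{-2}` with remainder `O(a_j^{-4})`
(`exists_levelCov_zero_expansion`). The increment cancels the constant term, and dividing by
`a_{j+1}^{-2} - a_{j+2}^{-2}` isolates the second coefficient. What remains is `O(a_j^{-2})` in both
statistics, which vanishes after multiplication by `√m_j` because `m_j a_j^{-4} → 0`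
(`tendsto_bias`, `tendsto_bias_increment`).
-/

namespace CyclicLongMemory

/-! ### Quadratic forms in Gaussian vectors -/

/-- The characteristic function of `g² - 1` for a standard Gaussian `g`. -/
noncomputable def chiSqCharFun (s : ℝ) : ℂ :=
  ∫ g : ℝ, Complex.exp ((s * (g ^ 2 - 1) : ℝ) * Complex.I) ∂gaussianReal 0 1

/-- The fourth moment of the standard Gaussian law, as the fourth derivative of its moment
generating function. -/
lemma integral_pow_four_gaussianReal : ∫ x : ℝ, x ^ 4 ∂gaussianReal 0 1 = 3 := by
  have h := iteratedDeriv_mgf_zero (X := id) (μ := gaussianReal 0 1)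
    (by simp [integrableExpSet_id_gaussianReal]) 4
  have h2 : (fun x : ℝ => x ^ 4) = (id : ℝ → ℝ) ^ 4 := rfl
  rw [h2, ← h, mgf_id_gaussianReal]
  -- Differentiation of `P(t) exp(t² / 2)` replaces the factor `P` by `P' + t P`.
  have key : ∀ (P Q : ℝ → ℝ), (∀ t, HasDerivAt P (Q t) t) →
      deriv (fun t => P t * Real.exp (t ^ 2 / 2)) =
        fun t => (Q t + t * P t) * Real.exp (t ^ 2 / 2) := by
    intro P Q hP
    ext t
    have h1 : HasDerivAt (fun t : ℝ => t ^ 2 / 2) t t := by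
      have := (hasDerivAt_pow 2 t).div_const 2
      convert! this using 1
      simp
    rw [HasDerivAt.deriv (HasDerivAt.fun_mul (hP t) h1.exp)]
    ring
  have e0 : (fun t : ℝ => Real.exp (((0 : ℝ)) * t + ((1 : NNReal) : ℝ) * t ^ 2 / 2)) =
      fun t => (fun _ => 1 : ℝ → ℝ) t * Real.exp (t ^ 2 / 2) := by
    ext t; simp
  rw [e0]
  simp only [iteratedDeriv_succ, iteratedDeriv_zero]
  rw [key _ (fun _ => 0) (fun t => hasDerivAt_const t 1)]
  rw [key (fun t => 0 + t * 1) (fun _ => 1) (fun t => by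
    simpa using hasDerivAt_id' t)]
  rw [key (fun t => 1 + t * (0 + t * 1)) (fun t => 2 * t) (fun t => by
    have := (hasDerivAt_pow 2 t).const_add 1
    convert! this using 1
    · ext; simp; ring
    · simp)]
  rw [key (fun t => 2 * t + t * (1 + t * (0 + t * 1))) (fun t => 3 + 3 * t ^ 2) (fun t => by
    have := (hasDerivAt_pow 3 t).add ((hasDerivAt_id t).const_mul 3)
    convert! this using 1
    · ext; simp; ring
    · simp; ring)]
  norm_num

/-- As `g² - 1` has mean `0` and variance `2`, its characteristic function agrees with `exp (-s²)`
to second order at `0`. -/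
lemma chiSqCharFun_sub_isLittleO :
    (fun s : ℝ => chiSqCharFun s - Complex.exp (-(s : ℂ) ^ 2)) =o[𝓝 0] fun s => s ^ 2 := by
  have hint : ∀ n : ℕ, Integrable (fun x : ℝ => x ^ n) (gaussianReal 0 1) := fun n => by
    have := (memLp_id_gaussianReal (μ := 0) (v := 1) n).integrable_norm_pow'
    simp only [id_eq, ← norm_pow] at this
    exact (integrable_norm_iff (by fun_prop)).1 this
  have h2 : ∫ x : ℝ, x ^ 2 ∂gaussianReal 0 1 = 1 := by
    have := variance_id_gaussianReal (μ := 0) (v := 1)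
    rw [variance_eq_sub (memLp_id_gaussianReal' _ (by simp))] at this
    simpa [integral_id_gaussianReal] using this
  set Y : ℝ → ℝ := fun g => (g ^ 2 - 1) / √2 with hY
  have hYm : Measurable Y := by fun_prop
  have h0 : (gaussianReal 0 1)[Y] = 0 := by
    simp only [hY]
    rw [integral_div, integral_sub (hint 2) (integrable_const _), h2]
    simp
  have h1 : (gaussianReal 0 1)[Y ^ 2] = 1 := by
    have : (Y ^ 2) = fun g => (g ^ 4 - 2 * g ^ 2 + 1) / 2 := by
      ext g; simp only [hY, Pi.pow_apply]; rw [div_pow, Real.sq_sqrt (by norm_num)]; ring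
    rw [this, integral_div, integral_add _ (integrable_const _),
      integral_sub (hint 4) ((hint 2).const_mul 2), integral_const_mul, h2,
      integral_pow_four_gaussianReal]
    · norm_num
    · exact (hint 4).sub ((hint 2).const_mul 2)
  have key := taylor_charFun_two hYm.aemeasurable h0 h1
  have hφ : ∀ s : ℝ, chiSqCharFun s = charFun ((gaussianReal 0 1).map Y) (√2 * s) := by
    intro s
    rw [charFun_apply_real, integral_map hYm.aemeasurable (by fun_prop)]
    refine integral_congr_ae (.of_forall fun g => ?_)
    simp only [hY]
    congr 2
    have : √2 ≠ 0 := by positivity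
    push_cast
    have : (√2 : ℂ) ≠ 0 := by exact_mod_cast this
    field_simp
  have htend : Tendsto (fun s : ℝ => √2 * s) (𝓝 0) (𝓝 0) := by
    have : Continuous (fun s : ℝ => √2 * s) := by fun_prop
    simpa using this.tendsto 0
  have k1 := key.comp_tendsto htend
  have k2 : (fun s : ℝ => chiSqCharFun s - (1 - (s : ℂ) ^ 2)) =o[𝓝 0] fun s : ℝ => s ^ 2 := by
    have : (fun t : ℝ => t ^ 2) ∘ (fun s : ℝ => √2 * s) = fun s => 2 * s ^ 2 := by
      ext s; simp [mul_pow]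
    rw [this] at k1
    have k1' := k1.trans_isBigO (Asymptotics.isBigO_const_mul_self 2 (fun s : ℝ => s ^ 2) (𝓝 0))
    refine k1'.congr_left fun s => ?_
    simp only [Function.comp_apply, hφ]
    congr 2
    push_cast
    rw [mul_pow, ← Complex.ofReal_pow, Real.sq_sqrt (by norm_num)]
    push_cast; ring
  have k3 : (fun s : ℝ => Complex.exp (-(s : ℂ) ^ 2) - (1 - (s : ℂ) ^ 2)) =o[𝓝 0]
      fun s : ℝ => s ^ 2 := by
    have hs : Tendsto (fun s : ℝ => s ^ 2) (𝓝 0) (𝓝 0) := by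
      have : Continuous (fun s : ℝ => s ^ 2) := by fun_prop
      simpa using this.tendsto 0
    have hexp : (fun x : ℝ => Real.exp (-x) - (1 - x)) =o[𝓝 0] fun x => x := by
      have : HasDerivAt (fun x : ℝ => Real.exp (-x)) (-1) 0 := by
        simpa using (hasDerivAt_neg (0 : ℝ)).exp
      have := (hasDerivAt_iff_isLittleO.1 this)
      simp only [neg_zero, Real.exp_zero, sub_zero, smul_eq_mul] at this
      refine this.congr_left fun x => by ring
    have := hexp.comp_tendsto hs
    rw [← Asymptotics.isLittleO_norm_left] at this ⊢
    refine this.congr (fun s => ?_) fun s => rfl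
    rw [← Complex.norm_real]
    simp
  refine (k2.sub k3).congr_left fun s => by ring

lemma norm_chiSqCharFun_le (s : ℝ) : ‖chiSqCharFun s‖ ≤ 1 := by
  refine (norm_integral_le_of_norm_le_const (C := 1) (.of_forall fun g => ?_)).trans ?_
  · rw [Complex.norm_exp_ofReal_mul_I]
  · simp

lemma norm_prod_sub_prod_le {ι : Type*} (s : Finset ι) (x y : ι → ℂ) (hx : ∀ i, ‖x i‖ ≤ 1)
    (hy : ∀ i, ‖y i‖ ≤ 1) : ‖∏ i ∈ s, x i - ∏ i ∈ s, y i‖ ≤ ∑ i ∈ s, ‖x i - y i‖ := by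
  classical
  induction s using Finset.induction_on with
  | empty => simp
  | insert a s ha ih =>
    rw [Finset.prod_insert ha, Finset.prod_insert ha, Finset.sum_insert ha]
    have : x a * ∏ i ∈ s, x i - y a * ∏ i ∈ s, y i =
      (x a - y a) * ∏ i ∈ s, x i + y a * (∏ i ∈ s, x i - ∏ i ∈ s, y i) := by ring
    rw [this]
    refine (norm_add_le _ _).trans ?_
    rw [norm_mul, norm_mul]
    gcongr ?_ + ?_
    · refine mul_le_of_le_one_right (norm_nonneg _) ?_
      rw [norm_prod]
      exact Finset.prod_le_one (fun i _ => norm_nonneg _) fun i _ => hx i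
    · exact (mul_le_of_le_one_left (norm_nonneg _) (hy a)).trans ih

open Matrix in
open scoped MatrixOrder in
/-- Diagonalization of a diagonal quadratic form in a centred Gaussian vector with covariance `R`:
it has the law of `∑ μᵢ gᵢ²` with independent standard Gaussian `gᵢ`, where the `μᵢ` are the
eigenvalues of `√R W √R`. These are also eigenvalues of `R W`, which gives the row sum bound. -/
lemma exists_eigenvalues_gaussian_quadForm {ι : Type*} [Fintype ι] [DecidableEq ι]
    {R : Matrix ι ι ℝ} (hR : R.PosSemidef) (w : ι → ℝ) (ρ : ℝ) (hρ : 0 ≤ ρ)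
    (hrow : ∀ k, ∑ l, |R k l * w l| ≤ ρ) :
    ∃ μ : ι → ℝ, (∀ i, |μ i| ≤ ρ) ∧ ∑ i, μ i ^ 2 = ∑ k, ∑ l, w k * w l * R k l ^ 2 ∧
      ∫ x, Complex.exp ((∑ k, w k * x k ^ 2 - ∑ k, w k * R k k : ℝ) * Complex.I)
        ∂(multivariateGaussian 0 R) = ∏ i, chiSqCharFun (μ i) := by
  set S : Matrix ι ι ℝ := CFC.sqrt R with hS
  have hSS : S * S = R := CFC.sqrt_mul_sqrt_self _ hR.nonneg
  have hSH : S.IsHermitian := (CFC.sqrt_nonneg R).isSelfAdjoint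
  set W : Matrix ι ι ℝ := diagonal w with hW
  have hWH : W.IsHermitian := by simp [hW, IsHermitian, conjTranspose, diagonal_transpose]
  have hH : (S * W * S).IsHermitian := by
    rw [IsHermitian, conjTranspose_mul, conjTranspose_mul, hSH.eq, hWH.eq, Matrix.mul_assoc]
  set μ := hH.eigenvalues with hμ
  set e := hH.eigenvectorBasis with he
  have hev : ∀ i, (S * W * S) *ᵥ (e i) = μ i • (e i : ι → ℝ) := fun i => by
    simpa using hH.mulVec_eigenvectorBasis i
  have htr1 : ∑ i, μ i = ∑ k, w k * R k k := by
    have h1 := hH.trace_eq_sum_eigenvalues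
    have h2 : (S * W * S).trace = (W * R).trace := by
      rw [trace_mul_comm, ← Matrix.mul_assoc, hSS, trace_mul_comm]
    rw [h2] at h1
    simpa [trace, hW, diagonal_mul] using h1.symm
  refine ⟨μ, ?_, ?_, ?_⟩
  -- If `e i` is an eigenvector of `√R W √R` then `√R (e i)`, if nonzero, is one of `R W`, so that
  -- Gershgorin's theorem for `R W` applies.
  · intro i
    by_cases hy : S *ᵥ (e i : ι → ℝ) = 0
    · have h1 := hev i
      rw [← mulVec_mulVec, hy, mulVec_zero] at h1
      have hne : (e i : ι → ℝ) ≠ 0 := fun h0 => by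
        have : e i = 0 := by ext k; exact congrFun h0 k
        simpa [this] using e.orthonormal.1 i
      rcases smul_eq_zero.1 h1.symm with h | h
      · simpa [h] using hρ
      · exact absurd h hne
    · have hE : Module.End.HasEigenvector (Matrix.toLin' (R * W)) (μ i) (S *ᵥ (e i : ι → ℝ)) := by
        refine ⟨?_, hy⟩
        rw [Module.End.mem_eigenspace_iff, toLin'_apply, ← hSS]
        have := congrArg (fun v => S *ᵥ v) (hev i)
        simp only [mulVec_mulVec, mulVec_smul] at this ⊢
        rw [← this]
        simp only [Matrix.mul_assoc]
      obtain ⟨k, hk⟩ := eigenvalue_mem_ball (Module.End.hasEigenvalue_of_hasEigenvector hE)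
      rw [mem_closedBall_iff_norm, Real.norm_eq_abs] at hk
      refine le_trans ?_ (hrow k)
      have h3 : ∀ l, (R * W) k l = R k l * w l := fun l => by simp [hW]
      simp only [h3, Real.norm_eq_abs] at hk
      rw [← Finset.add_sum_erase _ _ (Finset.mem_univ k)]
      calc |μ i| = |R k k * w k + (μ i - R k k * w k)| := by ring_nf
        _ ≤ _ := (abs_add_le _ _).trans (by gcongr)
  -- Both sides are the trace of `(√R W √R)²`, which is also the trace of `(W R)²`.
  · have h1 : (S * W * S * (S * W * S)).trace = ∑ i, μ i ^ 2 := by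
      have hsp := hH.spectral_theorem
      set U := hH.eigenvectorUnitary
      rw [Unitary.conjStarAlgAut_apply] at hsp
      have hUU : (star (U : Matrix ι ι ℝ)) * (U : Matrix ι ι ℝ) = 1 := by simp
      conv_lhs => rw [hsp]
      set D : Matrix ι ι ℝ := diagonal (RCLike.ofReal ∘ hH.eigenvalues)
      have : (U : Matrix ι ι ℝ) * D * star (U : Matrix ι ι ℝ) *
          ((U : Matrix ι ι ℝ) * D * star (U : Matrix ι ι ℝ)) =
          (U : Matrix ι ι ℝ) * (D * D * star (U : Matrix ι ι ℝ)) := by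
        calc _ = (U : Matrix ι ι ℝ) * D * (star (U : Matrix ι ι ℝ) *
          (U : Matrix ι ι ℝ)) * D * star (U : Matrix ι ι ℝ) := by simp only [Matrix.mul_assoc]
          _ = _ := by rw [hUU]; simp only [Matrix.mul_assoc, Matrix.one_mul]
      rw [this, trace_mul_comm, Matrix.mul_assoc, hUU, Matrix.mul_one, diagonal_mul_diagonal,
        trace_diagonal]
      simp [hμ, sq]
    rw [← h1]
    have h2 : (S * W * S * (S * W * S)).trace = (W * R * (W * R)).trace := by
      calc _ = (S * (W * (S * S) * W * S)).trace := by simp only [Matrix.mul_assoc]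
        _ = (W * (S * S) * W * S * S).trace := trace_mul_comm _ _
        _ = _ := by rw [Matrix.mul_assoc _ S S, hSS]; simp only [Matrix.mul_assoc]
    rw [h2, trace]
    refine Finset.sum_congr rfl fun k _ => ?_
    rw [diag_apply, mul_apply]
    refine Finset.sum_congr rfl fun l _ => ?_
    have hsym : R l k = R k l := by simpa using hR.1.apply k l
    simp [hW, diagonal_mul, hsym]
    ring
  -- The Gaussian vector is `√R z` with `z` standard, and the coordinates of `z` in the eigenbasis
  -- are independent standard Gaussian variables.
  · have hquad : ∀ x : ι → ℝ,
        ∑ k, w k * (S *ᵥ ((∑ i, x i • e i : EuclideanSpace ℝ ι) : ι → ℝ)) k ^ 2 =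
          ∑ i, μ i * x i ^ 2 := by
      intro x
      set z : EuclideanSpace ℝ ι := ∑ i, x i • e i with hz
      have hzf : (z : ι → ℝ) = ∑ i, x i • (e i : ι → ℝ) := by
        rw [hz]; simp
      have h1 : (S * W * S) *ᵥ (z : ι → ℝ) = ∑ i, (x i * μ i) • (e i : ι → ℝ) := by
        rw [hzf, mulVec_sum]
        refine Finset.sum_congr rfl fun i _ => ?_
        rw [mulVec_smul, hev, smul_smul]
      have h2 : (z : ι → ℝ) ⬝ᵥ ((S * W * S) *ᵥ (z : ι → ℝ)) = ∑ i, μ i * x i ^ 2 := by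
        have hort : ∀ i, (z : ι → ℝ) ⬝ᵥ (e i : ι → ℝ) = x i := by
          intro i
          have : inner ℝ (e i) z = x i := by
            rw [hz, e.orthonormal.inner_right_fintype]
          rw [← this, EuclideanSpace.inner_eq_star_dotProduct]
          simp
        rw [h1, dotProduct_sum]
        refine Finset.sum_congr rfl fun i _ => ?_
        rw [dotProduct_smul, hort, smul_eq_mul]
        ring
      rw [← h2, ← mulVec_mulVec, ← mulVec_mulVec, dotProduct_mulVec]
      have hST : (z : ι → ℝ) ᵥ* S = S *ᵥ (z : ι → ℝ) := by
        rw [← mulVec_transpose]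
        congr 1
      rw [hST, dotProduct]
      refine Finset.sum_congr rfl fun k _ => ?_
      rw [hW, mulVec_diagonal]
      ring
    rw [multivariateGaussian, integral_map (by fun_prop) (by fun_prop),
      stdGaussian_eq_map_pi_orthonormalBasis e,
      integral_map (Measurable.aemeasurable (by fun_prop)) (by fun_prop)]
    simp only [chiSqCharFun]
    rw [← integral_fintype_prod_eq_prod]
    refine integral_congr_ae (.of_forall fun x => ?_)
    simp only
    rw [← Complex.exp_sum, ← Finset.sum_mul, ← Complex.ofReal_sum]
    congr 3
    rw [← htr1]
    simp only [zero_add, ofLp_toEuclideanCLM]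
    rw [hquad, ← Finset.sum_sub_distrib]
    exact Finset.sum_congr rfl fun i _ => by ring

/-- Central limit theorem for diagonal quadratic forms in Gaussian vectors: if the row sums of `R W`
tend to zero uniformly and half the variance tends to `τ`, then the centred form is asymptotically
`N(0, 2τ)`; stated for characteristic functions at the point `1`. -/
theorem tendsto_charFun_gaussian_quadForm {ι : ℕ → Type*} [∀ j, Fintype (ι j)]
    [∀ j, DecidableEq (ι j)] (R : ∀ j, Matrix (ι j) (ι j) ℝ) (hR : ∀ j, (R j).PosSemidef)
    (w : ∀ j, ι j → ℝ) (ρ : ℕ → ℝ) (hρ : Tendsto ρ atTop (𝓝 0))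
    (hrow : ∀ᶠ j in atTop, ∀ k, ∑ l, |R j k l * w j l| ≤ ρ j) (hρ0 : ∀ j, 0 ≤ ρ j) (τ : ℝ)
    (hτ : Tendsto (fun j => ∑ k, ∑ l, w j k * w j l * R j k l ^ 2) atTop (𝓝 τ)) :
    Tendsto (fun j => ∫ x, Complex.exp
        ((∑ k, w j k * x k ^ 2 - ∑ k, w j k * R j k k : ℝ) * Complex.I)
        ∂(multivariateGaussian 0 (R j))) atTop (𝓝 (Complex.exp (-τ))) := by
  have hlim : Tendsto (fun j => Complex.exp (-((∑ k, ∑ l, w j k * w j l * R j k l ^ 2 : ℝ) : ℂ)))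
      atTop (𝓝 (Complex.exp (-τ))) := by
    refine ((Complex.continuous_exp.comp (continuous_neg.comp Complex.continuous_ofReal)).tendsto
      τ).comp hτ
  refine (tendsto_iff_of_dist ?_).2 hlim
  rw [Metric.tendsto_atTop']
  intro ε hε
  have hev := chiSqCharFun_sub_isLittleO.def (c := ε / (2 * (|τ| + 1))) (by positivity)
  obtain ⟨δ, hδ, hδ'⟩ := Metric.eventually_nhds_iff.1 hev
  have hb : ∀ᶠ j in atTop, ∑ k, ∑ l, w j k * w j l * R j k l ^ 2 < |τ| + 1 :=
    hτ.eventually_lt_const (by linarith [le_abs_self τ])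
  have hs : ∀ᶠ j in atTop, ρ j < δ := hρ.eventually_lt_const hδ
  obtain ⟨N, hN⟩ := eventually_atTop.1 (hb.and (hs.and hrow))
  refine ⟨N, fun j hj => ?_⟩
  obtain ⟨h1, h2, h3⟩ := hN j hj.le
  obtain ⟨μ, hμ1, hμ2, hμ3⟩ := exists_eigenvalues_gaussian_quadForm (hR j) (w j) (ρ j) (hρ0 j) h3
  -- The two products differ by at most the sum of the errors of the factors, of order `o(∑ μᵢ²)`.
  have hd : ‖∏ i, chiSqCharFun (μ i) - ∏ i, Complex.exp (-(μ i : ℂ) ^ 2)‖ ≤ ε / 2 := by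
    refine (norm_prod_sub_prod_le _ _ _ (fun i => norm_chiSqCharFun_le _) fun i => ?_).trans ?_
    · rw [Complex.norm_exp, Real.exp_le_one_iff]
      rw [← Complex.ofReal_pow]
      simp only [Complex.neg_re, Complex.ofReal_re]
      nlinarith [sq_nonneg (μ i)]
    · calc _ ≤ ∑ i, ε / (2 * (|τ| + 1)) * ‖μ i ^ 2‖ := Finset.sum_le_sum fun i _ =>
            hδ' (by simpa using (hμ1 i).trans_lt h2)
        _ = ε / (2 * (|τ| + 1)) * ∑ i, μ i ^ 2 := by
            rw [Finset.mul_sum]; simp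
        _ ≤ ε / (2 * (|τ| + 1)) * (|τ| + 1) := by
            gcongr; rw [hμ2]; exact h1.le
        _ = ε / 2 := by field_simp
  rw [dist_zero_right, Real.norm_eq_abs, abs_of_nonneg dist_nonneg, hμ3, dist_eq_norm, ← hμ2]
  push_cast
  rw [← Finset.sum_neg_distrib, Complex.exp_sum]
  exact hd.trans_lt (by linarith)

/-! ### Time integrals of a stationary Gaussian process -/

lemma integral_smul_comp_simpleFunc {E : Type*} [NormedAddCommGroup E] [NormedSpace ℝ E]
    [CompleteSpace E]
    {Φ : ℝ → ℝ} (hΦ : Integrable Φ) (φ : SimpleFunc ℝ ℝ) (G : ℝ → E) :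
    ∫ t, Φ t • G (φ t) = ∑ y ∈ φ.range, (∫ t in φ ⁻¹' {y}, Φ t) • G y := by
  have h : ∀ t, Φ t • G (φ t) = ∑ y ∈ φ.range, (φ ⁻¹' {y}).indicator Φ t • G y := by
    intro t
    rw [Finset.sum_eq_single (φ t)]
    · simp
    · intro y _ hy
      rw [Set.indicator_of_notMem, zero_smul]
      simpa using hy.symm
    · intro h
      exact absurd (φ.mem_range_self t) h
  simp_rw [h]
  rw [integral_finsetSum]
  · refine Finset.sum_congr rfl fun y _ => ?_
    rw [integral_smul_const, integral_indicator (φ.measurableSet_fiber y)]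
  · exact fun y _ => (hΦ.indicator (φ.measurableSet_fiber y)).smul_const _

lemma norm_exp_mul_I_sub_le (x y : ℝ) :
    ‖Complex.exp (x * Complex.I) - Complex.exp (y * Complex.I)‖ ≤ ‖x - y‖ := by
  have h : Complex.exp (x * Complex.I) - Complex.exp (y * Complex.I) =
      Complex.exp (y * Complex.I) * (Complex.exp (Complex.I * (x - y : ℝ)) - 1) := by
    rw [mul_sub, ← Complex.exp_add, mul_one]
    congr 2
    push_cast; ring
  rw [h, norm_mul, Complex.norm_exp_ofReal_mul_I, one_mul]
  exact Real.norm_exp_I_mul_ofReal_sub_one_le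

lemma integral_abs_le_sqrt {Ω : Type*} [MeasurableSpace Ω] {P : Measure Ω} [IsProbabilityMeasure P]
    {Y : Ω → ℝ} (hY : MemLp Y 2 P) : ∫ ω, |Y ω| ∂P ≤ √(∫ ω, Y ω ^ 2 ∂P) := by
  refine Real.le_sqrt_of_sq_le ?_
  have h := variance_nonneg (fun ω => |Y ω|) P
  rw [variance_eq_sub (X := fun ω => |Y ω|) hY.abs] at h
  simpa [sq_abs] using h

section TimeIntegrals

variable {Ω : Type*} [MeasurableSpace Ω] {P : Measure Ω} {X : ℝ → Ω → ℝ} {f : ℝ → ℝ}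

lemma IsStationaryGaussian.memLp (hX : IsStationaryGaussian P X f) (t : ℝ) : MemLp (X t) 2 P :=
  (hX.gaussian.hasGaussianLaw_eval t).memLp_two

lemma IsStationaryGaussian.cov_self (hX : IsStationaryGaussian P X f) (t : ℝ) :
    cov[X t, X t; P] = ∫ u, f u := by
  have h := hX.covariance_eq t t
  simp only [sub_self, mul_zero, Complex.exp_zero, one_mul] at h
  rw [integral_complex_ofReal] at h
  exact_mod_cast h

variable [IsProbabilityMeasure P]

lemma IsStationaryGaussian.integral_sq (hX : IsStationaryGaussian P X f) (t : ℝ) :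
    ∫ ω, X t ω ^ 2 ∂P = ∫ u, f u := by
  rw [← hX.cov_self t, covariance_eq_sub (hX.memLp t) (hX.memLp t), hX.centred]
  simp [sq]

lemma IsStationaryGaussian.integral_abs_le (hX : IsStationaryGaussian P X f) (t : ℝ) :
    ∫ ω, |X t ω| ∂P ≤ √(∫ u, f u) := by
  rw [← hX.integral_sq t]
  exact integral_abs_le_sqrt (hX.memLp t)

lemma IsStationaryGaussian.integrable (hX : IsStationaryGaussian P X f) (t : ℝ) :
    Integrable (X t) P := (hX.memLp t).integrable (by simp)

/-- Fubini integrability for `Φ(t) X(τ(t), ω)` with `Φ` integrable and a measurable time change. -/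
lemma IsStationaryGaussian.integrable_prod (hX : IsStationaryGaussian P X f) {Φ : ℝ → ℝ}
    (hΦ : Integrable Φ) {τ : ℝ → ℝ} (hτ : Measurable τ) :
    Integrable (fun z : ℝ × Ω => Φ z.1 * X (τ z.1) z.2) (volume.prod P) := by
  have hm : Measurable fun z : ℝ × Ω => X (τ z.1) z.2 :=
    hX.measurable.comp ((hτ.comp measurable_fst).prodMk measurable_snd)
  have hs : AEStronglyMeasurable (fun z : ℝ × Ω => Φ z.1 * X (τ z.1) z.2) (volume.prod P) :=
    hΦ.1.comp_fst.mul hm.aestronglyMeasurable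
  rw [integrable_prod_iff hs]
  refine ⟨.of_forall fun t => (hX.integrable (τ t)).const_mul (Φ t), ?_⟩
  refine (hΦ.norm.mul_const (√(∫ u, f u))).mono' hs.norm.integral_prod_right' ?_
  refine .of_forall fun t => ?_
  rw [Real.norm_of_nonneg (integral_nonneg fun _ => norm_nonneg _)]
  simp only [norm_mul, Real.norm_eq_abs]
  rw [integral_const_mul]
  gcongr
  exact hX.integral_abs_le _

/-- The characteristic function of a finite linear combination of values of the process. -/
lemma IsStationaryGaussian.integral_exp_sum (hX : IsStationaryGaussian P X f) (s : Finset ℝ)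
    (c : ℝ → ℝ) :
    ∫ ω, Complex.exp ((∑ y ∈ s, c y * X y ω : ℝ) * Complex.I) ∂P =
      Complex.exp (-((1 / 2 *
        ∫ u : ℝ, ‖∑ y ∈ s, c y • Complex.exp (Complex.I * u * y)‖ ^ 2 * f u : ℝ) : ℂ)) := by
  have hG : HasGaussianLaw (fun ω => ∑ y ∈ s, c y • X y ω) P :=
    (hX.gaussian.smul c).hasGaussianLaw_fun_sum
  have h1 := hG.charFun_map_eq (1 : ℝ)
  rw [charFun_apply_real, integral_map hG.aemeasurable (by fun_prop)] at h1
  simp only [smul_eq_mul, Complex.ofReal_one, one_mul, RCLike.inner_apply, conj_trivial,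
    mul_one] at h1
  rw [h1]
  have hmean : ∫ ω, ∑ y ∈ s, c y * X y ω ∂P = 0 := by
    rw [integral_finsetSum _ fun y _ => (hX.integrable y).const_mul _]
    simp [integral_const_mul, hX.centred]
  have hvar : Var[fun ω => ∑ y ∈ s, c y * X y ω; P] =
      ∫ u : ℝ, ‖∑ y ∈ s, c y • Complex.exp (Complex.I * u * y)‖ ^ 2 * f u := by
    rw [variance_fun_sum' fun y _ => (hX.memLp y).const_mul _]
    have hexp : ∀ y z : ℝ, Integrable fun u : ℝ =>
        Complex.exp (Complex.I * u * (y - z)) * (f u : ℂ) := fun y z => by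
      refine (hX.density_integrable.ofReal (𝕜 := ℂ)).bdd_mul (c := 1)
        (by fun_prop) (.of_forall fun u => ?_)
      have : Complex.I * u * (y - z) = ((u * (y - z) : ℝ) : ℂ) * Complex.I := by push_cast; ring
      rw [this, Complex.norm_exp_ofReal_mul_I]
    have hpt : ∀ u : ℝ, ((‖∑ y ∈ s, c y • Complex.exp (Complex.I * u * y)‖ ^ 2 * f u : ℝ) : ℂ) =
        ∑ y ∈ s, ∑ z ∈ s, ((c y : ℂ) * (c z : ℂ)) *
          (Complex.exp (Complex.I * u * (y - z)) * (f u : ℂ)) := by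
      intro u
      push_cast
      rw [← Complex.mul_conj', map_sum, Finset.sum_mul_sum, Finset.sum_mul]
      refine Finset.sum_congr rfl fun y _ => ?_
      rw [Finset.sum_mul]
      refine Finset.sum_congr rfl fun z _ => ?_
      have : Complex.exp (Complex.I * u * (y - z)) = Complex.exp (Complex.I * u * y) *
          (starRingEnd ℂ) (Complex.exp (Complex.I * u * z)) := by
        rw [← Complex.exp_conj, ← Complex.exp_add]
        congr 1
        simp only [map_mul, Complex.conj_I, Complex.conj_ofReal]
        ring
      rw [this]
      simp only [Complex.real_smul, map_mul, Complex.conj_ofReal]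
      ring
    have : ((∫ u : ℝ, ‖∑ y ∈ s, c y • Complex.exp (Complex.I * u * y)‖ ^ 2 * f u : ℝ) : ℂ) =
        ((∑ y ∈ s, ∑ z ∈ s, c y * c z * cov[X y, X z; P] : ℝ) : ℂ) := by
      rw [← integral_complex_ofReal]
      simp_rw [hpt]
      rw [integral_finsetSum _ fun y _ => integrable_finsetSum _ fun z _ => (hexp y z).const_mul _]
      push_cast
      refine Finset.sum_congr rfl fun y _ => ?_
      rw [integral_finsetSum _ fun z _ => (hexp y z).const_mul _]
      refine Finset.sum_congr rfl fun z _ => ?_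
      rw [integral_const_mul, hX.covariance_eq]
    rw [Complex.ofReal_inj.1 this]
    refine Finset.sum_congr rfl fun y _ => Finset.sum_congr rfl fun z _ => ?_
    rw [covariance_const_mul_left, covariance_const_mul_right]
    ring
  rw [hmean, hvar]
  congr 1
  push_cast
  ring

/-- **Gaussianity of weighted time integrals**: for integrable `Φ` the variable `∫ Φ(t) X(t) dt` is
centred Gaussian with variance `∫ |∫ Φ(t) e^{iut} dt|² f(u) du`. The time variable is approximated
by simple functions, which turns the integral into finite linear combinations of values of `X`. -/
theorem IsStationaryGaussian.integral_exp_integral (hX : IsStationaryGaussian P X f) {Φ : ℝ → ℝ}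
    (hΦ : Integrable Φ) :
    ∫ ω, Complex.exp ((∫ t, Φ t * X t ω : ℝ) * Complex.I) ∂P =
      Complex.exp (-((1 / 2 * ∫ u : ℝ, ‖∫ t, Φ t • Complex.exp (Complex.I * u * t)‖ ^ 2 * f u : ℝ)
        : ℂ)) := by
  set φ : ℕ → SimpleFunc ℝ ℝ := fun n =>
    SimpleFunc.approxOn id measurable_id Set.univ 0 (Set.mem_univ _) n with hφ
  have hφt : ∀ t, Tendsto (fun n => φ n t) atTop (𝓝 t) := fun t =>
    SimpleFunc.tendsto_approxOn measurable_id (Set.mem_univ _) (by simp)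
  set v := √(∫ u, f u) with hv
  have hS : ∀ n ω, ∫ t, Φ t * X (φ n t) ω =
      ∑ y ∈ (φ n).range, (∫ t in φ n ⁻¹' {y}, Φ t) * X y ω := fun n ω =>
    integral_smul_comp_simpleFunc hΦ (φ n) fun y => X y ω
  have hE : ∀ n (u : ℝ), ∫ t, Φ t • Complex.exp (Complex.I * u * (φ n t)) =
      ∑ y ∈ (φ n).range, (∫ t in φ n ⁻¹' {y}, Φ t) • Complex.exp (Complex.I * u * y) := fun n u =>
    integral_smul_comp_simpleFunc hΦ (φ n) fun y : ℝ => Complex.exp (Complex.I * u * y)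
  have hnorm : ∀ u y : ℝ, ‖Complex.exp (Complex.I * u * y)‖ = 1 := fun u y => by
    have : Complex.I * u * y = ((u * y : ℝ) : ℂ) * Complex.I := by push_cast; ring
    rw [this, Complex.norm_exp_ofReal_mul_I]
  have hint := hX.integrable_prod hΦ (τ := fun t => t) measurable_id
  have hintn : ∀ n, Integrable (fun z : ℝ × Ω => Φ z.1 * X (φ n z.1) z.2) (volume.prod P) :=
    fun n => hX.integrable_prod hΦ (φ n).measurable
  have hinner : ∀ u : ℝ, Tendsto (fun n => ∫ t, Φ t • Complex.exp (Complex.I * u * (φ n t))) atTop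
      (𝓝 (∫ t, Φ t • Complex.exp (Complex.I * u * t))) := fun u => by
    refine tendsto_integral_of_dominated_convergence (fun t => ‖Φ t‖) (fun n => ?_) hΦ.norm ?_ ?_
    · refine hΦ.1.smul (Measurable.aestronglyMeasurable ?_)
      have := (φ n).measurable
      fun_prop
    · intro n
      refine .of_forall fun t => ?_
      rw [norm_smul, hnorm, mul_one]
    · refine .of_forall fun t => ?_
      have : Continuous fun y : ℝ => Φ t • Complex.exp (Complex.I * u * y) := by fun_prop
      exact (this.tendsto t).comp (hφt t)
  have hbd : ∀ (τ : ℝ → ℝ) (u : ℝ), ‖∫ t, Φ t • Complex.exp (Complex.I * u * (τ t))‖ ≤ ∫ t, ‖Φ t‖ :=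
    fun τ u => (norm_integral_le_integral_norm _).trans
      (by simp only [norm_smul, hnorm, mul_one]; rfl)
  have hR : Tendsto (fun n => ∫ u : ℝ, ‖∫ t, Φ t • Complex.exp (Complex.I * u * (φ n t))‖ ^ 2 * f u)
      atTop (𝓝 (∫ u : ℝ, ‖∫ t, Φ t • Complex.exp (Complex.I * u * t)‖ ^ 2 * f u)) := by
    refine tendsto_integral_of_dominated_convergence (fun u => (∫ t, ‖Φ t‖) ^ 2 * f u)
      (fun n => ?_) (hX.density_integrable.const_mul _) ?_ ?_
    · simp_rw [hE]
      exact (Continuous.aestronglyMeasurable (by fun_prop)).mul hX.density_integrable.1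
    · intro n
      refine .of_forall fun u => ?_
      rw [norm_mul, norm_pow, norm_norm, Real.norm_of_nonneg (hX.density_nonneg u)]
      have := hX.density_nonneg u
      gcongr
      exact hbd _ _
    · exact .of_forall fun u => ((hinner u).norm.pow 2).mul_const _
  have hR' : Tendsto (fun n => Complex.exp (-((1 / 2 *
      ∫ u : ℝ, ‖∫ t, Φ t • Complex.exp (Complex.I * u * (φ n t))‖ ^ 2 * f u : ℝ) : ℂ))) atTop
      (𝓝 (Complex.exp (-((1 / 2 *
        ∫ u : ℝ, ‖∫ t, Φ t • Complex.exp (Complex.I * u * t)‖ ^ 2 * f u : ℝ) : ℂ)))) := by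
    have hc : Continuous fun x : ℝ => Complex.exp (-((1 / 2 * x : ℝ) : ℂ)) := by fun_prop
    exact (hc.tendsto _).comp hR
  have hLn : ∀ n, Complex.exp (-((1 / 2 *
      ∫ u : ℝ, ‖∫ t, Φ t • Complex.exp (Complex.I * u * (φ n t))‖ ^ 2 * f u : ℝ) : ℂ)) =
      ∫ ω, Complex.exp ((∫ t, Φ t * X (φ n t) ω : ℝ) * Complex.I) ∂P := fun n => by
    simp_rw [hE, hS]
    exact (hX.integral_exp_sum _ _).symm
  simp_rw [hLn] at hR'
  refine tendsto_nhds_unique ?_ hR'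
  -- The `L¹` distance between the approximating and the limiting time integral.
  have hD : Tendsto (fun n => ∫ t, ∫ ω, ‖Φ t * X (φ n t) ω - Φ t * X t ω‖ ∂P) atTop (𝓝 0) := by
    have h0 : (0 : ℝ) = ∫ t : ℝ, (0 : ℝ) := by simp
    rw [h0]
    refine tendsto_integral_of_dominated_convergence (fun t => ‖Φ t‖ * (2 * v)) (fun n => ?_)
      (hΦ.norm.mul_const _) ?_ ?_
    · exact ((hintn n).sub hint).norm.1.integral_prod_right'
    · intro n
      refine .of_forall fun t => ?_
      rw [Real.norm_of_nonneg (integral_nonneg fun _ => norm_nonneg _)]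
      simp_rw [← mul_sub, norm_mul]
      rw [integral_const_mul]
      gcongr
      calc ∫ ω, ‖X (φ n t) ω - X t ω‖ ∂P ≤ ∫ ω, (|X (φ n t) ω| + |X t ω|) ∂P := by
            refine integral_mono ((hX.integrable _).sub (hX.integrable _)).norm
              ((hX.integrable _).abs.add (hX.integrable _).abs) fun ω => abs_sub _ _
        _ ≤ 2 * v := by
            rw [integral_add (hX.integrable _).abs (hX.integrable _).abs]
            linarith [hX.integral_abs_le (φ n t), hX.integral_abs_le t]
    · refine .of_forall fun t => ?_
      simp_rw [← mul_sub, norm_mul, integral_const_mul]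
      rw [← mul_zero ‖Φ t‖]
      refine Tendsto.const_mul _ ?_
      have h1 : Tendsto (fun n => √(∫ ω, (X (φ n t) ω - X t ω) ^ 2 ∂P)) atTop (𝓝 0) := by
        have := (Real.continuous_sqrt.tendsto 0).comp ((hX.msContinuous t).comp (hφt t))
        simpa [Function.comp_def] using this
      refine squeeze_zero (fun n => integral_nonneg fun _ => norm_nonneg _) (fun n => ?_) h1
      exact integral_abs_le_sqrt ((hX.memLp _).sub (hX.memLp _))
  have hSm : ∀ τ : ℝ → ℝ, Integrable (fun z : ℝ × Ω => Φ z.1 * X (τ z.1) z.2) (volume.prod P) →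
      AEStronglyMeasurable (fun ω => Complex.exp ((∫ t, Φ t * X (τ t) ω : ℝ) * Complex.I)) P := by
    intro τ h
    have h2 := h.swap.1.integral_prod_right'
    simp only [Function.comp_apply, Prod.fst_swap, Prod.snd_swap] at h2
    have hc : Continuous fun x : ℝ => Complex.exp (x * Complex.I) := by fun_prop
    exact hc.comp_aestronglyMeasurable h2
  have hSi : ∀ τ : ℝ → ℝ, Integrable (fun z : ℝ × Ω => Φ z.1 * X (τ z.1) z.2) (volume.prod P) →
      Integrable (fun ω => Complex.exp ((∫ t, Φ t * X (τ t) ω : ℝ) * Complex.I)) P := by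
    intro τ h
    refine Integrable.of_bound (hSm τ h) 1 (.of_forall fun ω => ?_)
    rw [Complex.norm_exp_ofReal_mul_I]
  refine tendsto_iff_norm_sub_tendsto_zero.2 ?_
  refine squeeze_zero (fun n => norm_nonneg _) (fun n => ?_) hD
  rw [← integral_sub (hSi _ (hintn n)) (hSi (fun t => t) hint)]
  refine (norm_integral_le_integral_norm _).trans ?_
  rw [integral_integral_swap ((hintn n).sub hint).norm]
  refine integral_mono_ae ((hSi _ (hintn n)).sub (hSi (fun t => t) hint)).norm
    ((hintn n).sub hint).norm.swap.integral_prod_left ?_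
  filter_upwards [(hintn n).prod_left_ae, hint.prod_left_ae] with ω h1 h2
  calc _ ≤ ‖(∫ t, Φ t * X (φ n t) ω) - ∫ t, Φ t * X t ω‖ := by
        exact norm_exp_mul_I_sub_le _ _
    _ ≤ _ := by
        rw [← integral_sub h1 h2]
        exact norm_integral_le_integral_norm _

end TimeIntegrals

/-! ### Covariances of the filter coefficients -/

/-- The conjugate Fourier transform `∫ Φ(t) e^{iut} dt` of a weight function. -/
noncomputable def weightTransform (Φ : ℝ → ℝ) (u : ℝ) : ℂ :=
  ∫ t, Φ t • Complex.exp (Complex.I * u * t)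

lemma weightTransform_eq_hat (ψ : ℝ → ℝ) (u : ℝ) : weightTransform ψ u = hat ψ (-u) := by
  refine integral_congr_ae (.of_forall fun t => ?_)
  simp only [Complex.real_smul, Complex.ofReal_neg]
  rw [mul_comm]
  congr 2
  ring

lemma integrable_smul_exp {Φ : ℝ → ℝ} (hΦ : Integrable Φ) (u : ℝ) :
    Integrable fun t : ℝ => Φ t • Complex.exp (Complex.I * u * t) := by
  refine hΦ.norm.mono' (hΦ.1.smul (Continuous.aestronglyMeasurable (by fun_prop)))
    (.of_forall fun t => ?_)
  have : Complex.I * u * t = ((u * t : ℝ) : ℂ) * Complex.I := by push_cast; ring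
  rw [norm_smul, this, Complex.norm_exp_ofReal_mul_I, mul_one]

lemma continuous_weightTransform {Φ : ℝ → ℝ} (hΦ : Integrable Φ) :
    Continuous (weightTransform Φ) := by
  refine continuous_of_dominated (bound := fun t => ‖Φ t‖)
    (fun u => (integrable_smul_exp hΦ u).1) (fun u => .of_forall fun t => ?_) hΦ.norm
    (.of_forall fun t => by fun_prop)
  have : Complex.I * u * t = ((u * t : ℝ) : ℂ) * Complex.I := by push_cast; ring
  rw [norm_smul, this, Complex.norm_exp_ofReal_mul_I, mul_one]

lemma norm_weightTransform_le (Φ : ℝ → ℝ) (u : ℝ) : ‖weightTransform Φ u‖ ≤ ∫ t, ‖Φ t‖ := by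
  refine (norm_integral_le_integral_norm _).trans_eq ?_
  refine integral_congr_ae (.of_forall fun t => ?_)
  have : Complex.I * u * t = ((u * t : ℝ) : ℂ) * Complex.I := by push_cast; ring
  simp only
  rw [norm_smul, this, Complex.norm_exp_ofReal_mul_I, mul_one]

lemma continuous_hat {ψ : ℝ → ℝ} (hψ : Integrable ψ) : Continuous (hat ψ) := by
  have h : hat ψ = fun u => weightTransform ψ (-u) := by
    ext u; rw [weightTransform_eq_hat, neg_neg]
  rw [h]
  exact (continuous_weightTransform hψ).comp continuous_neg

lemma norm_hat_le (ψ : ℝ → ℝ) (u : ℝ) : ‖hat ψ u‖ ≤ ∫ t, ‖ψ t‖ := by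
  have := norm_weightTransform_le ψ (-u)
  rwa [weightTransform_eq_hat, neg_neg] at this

lemma norm_hat_neg (ψ : ℝ → ℝ) (u : ℝ) : ‖hat ψ (-u)‖ = ‖hat ψ u‖ := by
  rw [← Complex.norm_conj (hat ψ u)]
  congr 1
  simp only [hat]
  rw [← integral_conj]
  refine integral_congr_ae (.of_forall fun t => ?_)
  simp only [map_mul, ← Complex.exp_conj, Complex.conj_ofReal, map_neg, Complex.conj_I]
  push_cast
  ring_nf

/-- The weight `t ↦ a^{-1/2} ψ((t - b) / a)` of a coefficient at scale `a` and shift `b`. -/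
noncomputable def filterWeight (ψ : ℝ → ℝ) (a b : ℝ) (t : ℝ) : ℝ := 1 / √a * ψ ((t - b) / a)

lemma integrable_filterWeight {ψ : ℝ → ℝ} (hψ : Integrable ψ) {a : ℝ} (ha : 0 < a) (b : ℝ) :
    Integrable (filterWeight ψ a b) :=
  ((hψ.comp_div ha.ne').comp_sub_right b).const_mul _

lemma weightTransform_filterWeight (ψ : ℝ → ℝ) {a : ℝ} (ha : 0 < a) (b u : ℝ) :
    weightTransform (filterWeight ψ a b) u =
      √a * Complex.exp (Complex.I * u * b) * hat ψ (-(a * u)) := by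
  rw [← weightTransform_eq_hat]
  simp only [weightTransform, filterWeight]
  have h1 : ∀ t : ℝ, (1 / √a * ψ ((t - b) / a)) • Complex.exp (Complex.I * u * t) =
      (fun s : ℝ => ((1 / √a : ℝ) * Complex.exp (Complex.I * u * b)) *
        (ψ s • Complex.exp (Complex.I * (a * u : ℝ) * s))) ((t - b) / a) := by
    intro t
    have : Complex.exp (Complex.I * u * t) = Complex.exp (Complex.I * u * b) *
        Complex.exp (Complex.I * (a * u : ℝ) * ((t - b) / a : ℝ)) := by
      rw [← Complex.exp_add]
      congr 1
      have : (a : ℂ) ≠ 0 := by exact_mod_cast ha.ne'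
      push_cast
      field_simp
      ring
    simp only [this, Complex.real_smul]
    push_cast
    ring
  simp_rw [h1]
  rw [integral_sub_right_eq_self (fun t : ℝ => (fun s : ℝ => ((1 / √a : ℝ) *
    Complex.exp (Complex.I * u * b)) * (ψ s • Complex.exp (Complex.I * (a * u : ℝ) * s))) (t / a))
    b,
    Measure.integral_comp_div (fun s : ℝ => ((1 / √a : ℝ) * Complex.exp (Complex.I * u * b)) *
      (ψ s • Complex.exp (Complex.I * (a * u : ℝ) * s))) a, integral_const_mul, abs_of_pos ha,
    Complex.real_smul]
  have h2 : (a : ℂ) * ((1 / √a : ℝ) : ℂ) = (√a : ℝ) := by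
    rw [← Complex.ofReal_mul, mul_one_div, Real.div_sqrt]
  rw [← mul_assoc, ← mul_assoc, h2]

lemma filterTransform_eq {Ω : Type*} (ψ : ℝ → ℝ) (X : ℝ → Ω → ℝ) (a : ℕ → ℝ) (b : ℕ → ℤ → ℝ)
    (j : ℕ) (k : ℤ) (ω : Ω) :
    filterTransform ψ X a b j k ω = ∫ t, filterWeight ψ (a j) (b j k) t * X t ω := by
  simp only [filterTransform, filterWeight, mul_assoc]
  rw [integral_const_mul]

section Law

variable {Ω : Type*} [MeasurableSpace Ω] {P : Measure Ω} [IsProbabilityMeasure P]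
  {X : ℝ → Ω → ℝ} {f : ℝ → ℝ}

lemma IsStationaryGaussian.aemeasurable_integral (hX : IsStationaryGaussian P X f) {Φ : ℝ → ℝ}
    (hΦ : Integrable Φ) : AEMeasurable (fun ω => ∫ t, Φ t * X t ω) P := by
  have h2 := (hX.integrable_prod hΦ (τ := fun t => t) measurable_id).swap.1.integral_prod_right'
  exact h2.aemeasurable

/-- The covariance matrix of the variables `∫ Φᵢ(t) X(t) dt`. -/
noncomputable def weightCov {ι : Type*} (f : ℝ → ℝ) (Φ : ι → ℝ → ℝ) : Matrix ι ι ℝ :=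
  Matrix.of fun i l => ∫ u, (weightTransform (Φ i) u *
    (starRingEnd ℂ) (weightTransform (Φ l) u)).re * f u

lemma integrable_weightCov (hf : Integrable f) {Φ Ψ : ℝ → ℝ} (hΦ : Integrable Φ)
    (hΨ : Integrable Ψ) : Integrable fun u => (weightTransform Φ u *
      (starRingEnd ℂ) (weightTransform Ψ u)).re * f u := by
  refine hf.bdd_mul (c := (∫ t, ‖Φ t‖) * ∫ t, ‖Ψ t‖) ?_ (.of_forall fun u => ?_)
  · have h1 := continuous_weightTransform hΦ
    have h2 := continuous_weightTransform hΨ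
    exact (Complex.continuous_re.comp
      (h1.mul (Complex.continuous_conj.comp h2))).aestronglyMeasurable
  · refine (Complex.abs_re_le_norm _).trans ?_
    rw [norm_mul, RCLike.norm_conj]
    gcongr <;> exact norm_weightTransform_le _ _

lemma weightCov_quadForm {ι : Type*} [Fintype ι] (hf : Integrable f) {Φ : ι → ℝ → ℝ}
    (hΦ : ∀ i, Integrable (Φ i)) (x : ι → ℝ) :
    x ⬝ᵥ (weightCov f Φ).mulVec x =
      ∫ u, ‖weightTransform (fun t => ∑ i, x i * Φ i t) u‖ ^ 2 * f u := by
  have hlin : ∀ u, weightTransform (fun t => ∑ i, x i * Φ i t) u =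
      ∑ i, (x i : ℂ) * weightTransform (Φ i) u := by
    intro u
    simp only [weightTransform]
    have : ∀ t : ℝ, (∑ i, x i * Φ i t) • Complex.exp (Complex.I * u * t) =
        ∑ i, (x i : ℂ) * (Φ i t • Complex.exp (Complex.I * u * t)) := by
      intro t
      rw [Finset.sum_smul]
      refine Finset.sum_congr rfl fun i _ => ?_
      simp only [Complex.real_smul, Complex.ofReal_mul, mul_assoc]
    simp_rw [this]
    rw [integral_finsetSum _ fun i _ => (integrable_smul_exp (hΦ i) u).const_mul _]
    simp_rw [integral_const_mul]
  have hpt : ∀ u, ‖weightTransform (fun t => ∑ i, x i * Φ i t) u‖ ^ 2 * f u =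
      ∑ i, ∑ l, x i * x l * ((weightTransform (Φ i) u *
        (starRingEnd ℂ) (weightTransform (Φ l) u)).re * f u) := by
    intro u
    have : ‖weightTransform (fun t => ∑ i, x i * Φ i t) u‖ ^ 2 =
        ((weightTransform (fun t => ∑ i, x i * Φ i t) u) *
          (starRingEnd ℂ) (weightTransform (fun t => ∑ i, x i * Φ i t) u)).re := by
      rw [Complex.mul_conj', ← Complex.ofReal_pow, Complex.ofReal_re]
    rw [this, hlin, map_sum, Finset.sum_mul_sum, Complex.re_sum, Finset.sum_mul]
    refine Finset.sum_congr rfl fun i _ => ?_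
    rw [Complex.re_sum, Finset.sum_mul]
    refine Finset.sum_congr rfl fun l _ => ?_
    rw [map_mul, Complex.conj_ofReal, mul_mul_mul_comm, ← Complex.ofReal_mul, Complex.re_ofReal_mul]
    ring
  simp_rw [hpt]
  have hi := fun i l => (integrable_weightCov hf (hΦ i) (hΦ l)).const_mul (x i * x l)
  rw [integral_finsetSum _ fun i _ => integrable_finsetSum _ fun l _ => hi i l]
  rw [dotProduct]
  refine Finset.sum_congr rfl fun i _ => ?_
  rw [integral_finsetSum _ fun l _ => hi i l, Matrix.mulVec, dotProduct, Finset.mul_sum]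
  refine Finset.sum_congr rfl fun l _ => ?_
  rw [integral_const_mul, weightCov, Matrix.of_apply]
  ring

lemma weightCov_posSemidef {ι : Type*} [Fintype ι] (hf : Integrable f) (hf0 : ∀ u, 0 ≤ f u)
    {Φ : ι → ℝ → ℝ} (hΦ : ∀ i, Integrable (Φ i)) : (weightCov f Φ).PosSemidef := by
  refine Matrix.PosSemidef.of_dotProduct_mulVec_nonneg ?_ fun x => ?_
  · ext i l
    simp only [Matrix.conjTranspose_apply, star_trivial, weightCov, Matrix.of_apply]
    refine integral_congr_ae (.of_forall fun u => ?_)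
    simp only [Complex.mul_re, Complex.conj_re, Complex.conj_im]
    ring
  · simp only [star_trivial]
    rw [weightCov_quadForm hf hΦ]
    exact integral_nonneg fun u => mul_nonneg (by positivity) (hf0 u)

/-- Joint Gaussianity of weighted time integrals of the process. -/
theorem IsStationaryGaussian.map_integral (hX : IsStationaryGaussian P X f) {ι : Type*} [Fintype ι]
    [DecidableEq ι] {Φ : ι → ℝ → ℝ} (hΦ : ∀ i, Integrable (Φ i)) :
    P.map (fun ω => WithLp.toLp 2 fun i => ∫ t, Φ i t * X t ω) =
      multivariateGaussian 0 (weightCov f Φ) := by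
  have hm : AEMeasurable (fun ω => (WithLp.toLp 2 fun i => ∫ t, Φ i t * X t ω :
      EuclideanSpace ℝ ι)) P :=
    (PiLp.continuous_toLp 2 _).measurable.comp_aemeasurable
      (aemeasurable_pi_lambda _ fun i => hX.aemeasurable_integral (hΦ i))
  have : IsProbabilityMeasure (P.map (fun ω => (WithLp.toLp 2 fun i => ∫ t, Φ i t * X t ω :
      EuclideanSpace ℝ ι))) := Measure.isProbabilityMeasure_map hm
  refine Measure.ext_of_charFun ?_
  ext x
  rw [charFun_multivariateGaussian
    (weightCov_posSemidef hX.density_integrable hX.density_nonneg hΦ),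
    weightCov_quadForm hX.density_integrable hΦ, charFun_apply, integral_map hm (by fun_prop)]
  have hΨ : Integrable fun t => ∑ i, x i * Φ i t :=
    integrable_finsetSum _ fun i _ => (hΦ i).const_mul _
  have h := hX.integral_exp_integral hΨ
  have hcongr : ∀ᵐ ω ∂P, Complex.exp ((∫ t, (∑ i, x i * Φ i t) * X t ω : ℝ) * Complex.I) =
      Complex.exp ((inner ℝ
        (WithLp.toLp 2 fun i => ∫ t, Φ i t * X t ω : EuclideanSpace ℝ ι) x : ℝ) * Complex.I) := by
    have hi : ∀ᵐ ω ∂P, ∀ i, Integrable fun t => Φ i t * X t ω := by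
      rw [ae_all_iff]
      exact fun i => (hX.integrable_prod (hΦ i) (τ := fun t => t) measurable_id).prod_left_ae
    filter_upwards [hi] with ω hω
    congr 3
    rw [EuclideanSpace.inner_eq_star_dotProduct, dotProduct]
    simp_rw [Finset.sum_mul, mul_assoc]
    rw [integral_finsetSum _ fun i _ => (hω i).const_mul _]
    simp_rw [integral_const_mul]
    simp
  rw [← integral_congr_ae hcongr, h]
  congr 1
  simp only [inner_zero_right, Complex.ofReal_zero, zero_mul, zero_sub, weightTransform]
  push_cast
  ring

end Law

/-- The covariance `r(k) = ∫ |F(η)|² cos(ηθk) f(ση) dη` of coefficients of one level, at relative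
scale `σ = 1 / a_j` and relative shift `θ = γ_j / a_j`. -/
noncomputable def levelCov (F : ℝ → ℂ) (f : ℝ → ℝ) (σ θ : ℝ) (k : ℤ) : ℝ :=
  ∫ η, ‖F η‖ ^ 2 * Real.cos (η * θ * k) * f (σ * η)

/-- Coefficients of one level with shifts differing by `γ n` have covariance `levelCov` at lag `n`,
by the substitution `η = a u`. -/
lemma weightCov_same_level {ψ f : ℝ → ℝ} {a : ℝ} (ha : 0 < a)
    (γ b b' : ℝ) (n : ℤ) (hb : b - b' = γ * n) :
    ∫ u, (weightTransform (filterWeight ψ a b) u *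
      (starRingEnd ℂ) (weightTransform (filterWeight ψ a b') u)).re * f u =
      levelCov (hat ψ) f a⁻¹ (γ / a) n := by
  have h : ∀ u, (weightTransform (filterWeight ψ a b) u *
      (starRingEnd ℂ) (weightTransform (filterWeight ψ a b') u)).re * f u =
      a * (fun η : ℝ => ‖hat ψ η‖ ^ 2 * Real.cos (η * (γ / a) * n) * f (a⁻¹ * η)) (u * a) := by
    intro u
    rw [weightTransform_filterWeight _ ha, weightTransform_filterWeight _ ha]
    have e1 : (√a * Complex.exp (Complex.I * u * b) * hat ψ (-(a * u))) *
        (starRingEnd ℂ) (√a * Complex.exp (Complex.I * u * b') * hat ψ (-(a * u))) =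
        ((a * ‖hat ψ (a * u)‖ ^ 2 : ℝ) : ℂ) * Complex.exp ((u * (γ * n) : ℝ) * Complex.I) := by
      rw [← norm_hat_neg ψ (a * u), ← hb]
      push_cast
      rw [← Complex.mul_conj' (hat ψ _)]
      simp only [map_mul, Complex.conj_ofReal, ← Complex.exp_conj, Complex.conj_I]
      have e2 : Complex.exp (u * (b - b') * Complex.I) =
          Complex.exp (Complex.I * u * b) * Complex.exp (-Complex.I * u * b') := by
        rw [← Complex.exp_add]; congr 1; ring
      have e3 : (√a : ℂ) * (√a : ℂ) = a := by
        rw [← Complex.ofReal_mul, Real.mul_self_sqrt ha.le]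
      rw [e2]
      linear_combination (Complex.exp (Complex.I * u * b) * Complex.exp (-Complex.I * u * b') *
        (hat ψ (-(a * u)) * (starRingEnd ℂ) (hat ψ (-(a * u))))) * e3
    rw [e1, Complex.re_ofReal_mul, Complex.exp_ofReal_mul_I_re]
    have e4 : u * a * (γ / a) * n = u * (γ * n) := by field_simp
    have e5 : a⁻¹ * (u * a) = u := by field_simp
    simp only [e4, e5]
    rw [mul_comm u a]
    ring
  simp_rw [h]
  rw [integral_const_mul, Measure.integral_comp_mul_right
    (fun η : ℝ => ‖hat ψ η‖ ^ 2 * Real.cos (η * (γ / a) * n) * f (a⁻¹ * η)),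
    abs_of_pos (by positivity), smul_eq_mul, ← mul_assoc, mul_inv_cancel₀ ha.ne', one_mul]
  rfl

/-- A continuous function supported in a closed annulus vanishes off the open annulus. -/
lemma mem_annulus_of_ne_zero {F : ℝ → ℂ} (hF : Continuous F) {A B : ℝ} (hB : 0 < B)
    (hs : tsupport F ⊆ {ξ : ℝ | B ≤ |ξ| ∧ |ξ| ≤ A}) {x : ℝ} (hx : F x ≠ 0) : B < |x| ∧ |x| < A := by
  have hopen : IsOpen {y | F y ≠ 0} := isOpen_ne_fun hF continuous_const
  obtain ⟨ε, hε, hball⟩ := Metric.isOpen_iff.1 hopen x hx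
  have hmem : ∀ y, |y - x| < ε → B ≤ |y| ∧ |y| ≤ A := fun y hy =>
    hs (subset_tsupport F (hball (by simpa [Real.dist_eq] using hy)))
  have hx0 := hmem x (by simpa using hε)
  rcases le_or_gt 0 x with h0 | h0
  · rw [abs_of_nonneg h0] at hx0 ⊢
    have h1 := hmem (x + ε / 2) (by simp [abs_of_pos, hε])
    have h2 := hmem (x - min (ε / 2) (B / 2)) (by
      rw [sub_sub_cancel_left, abs_neg, abs_of_pos (by positivity)]
      exact (min_le_left _ _).trans_lt (by linarith))
    have h3 : 0 < min (ε / 2) (B / 2) := by positivity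
    have h4 := min_le_right (ε / 2) (B / 2)
    rw [abs_of_nonneg (by linarith)] at h1 h2
    constructor <;> linarith
  · rw [abs_of_neg h0] at hx0 ⊢
    have h1 := hmem (x - ε / 2) (by simp [abs_of_pos, hε])
    have h2 := hmem (x + min (ε / 2) (B / 2)) (by
      rw [add_sub_cancel_left, abs_of_pos (by positivity)]
      exact (min_le_left _ _).trans_lt (by linarith))
    have h3 : 0 < min (ε / 2) (B / 2) := by positivity
    have h4 := min_le_right (ε / 2) (B / 2)
    rw [abs_of_nonpos (by linarith)] at h1 h2
    constructor <;> linarith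

/-- Coefficients of levels whose scale ratio is at least `A / B` are uncorrelated. -/
lemma weightCov_cross_level {ψ f : ℝ → ℝ} (hψ : Integrable ψ) {A B : ℝ} (hB : 0 < B)
    (hs : tsupport (hat ψ) ⊆ {ξ : ℝ | B ≤ |ξ| ∧ |ξ| ≤ A}) {a a' : ℝ} (ha : 0 < a)
    (ha' : 0 < a') (haa : A / B ≤ a' / a ∨ A / B ≤ a / a') (b b' : ℝ) :
    ∫ u, (weightTransform (filterWeight ψ a b) u *
      (starRingEnd ℂ) (weightTransform (filterWeight ψ a' b') u)).re * f u = 0 := by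
  -- The transforms of the two weights live on disjoint frequency bands.
  have key : ∀ u, hat ψ (-(a * u)) = 0 ∨ hat ψ (-(a' * u)) = 0 := by
    intro u
    by_contra! h
    have h1 := mem_annulus_of_ne_zero (continuous_hat hψ) hB hs h.1
    have h2 := mem_annulus_of_ne_zero (continuous_hat hψ) hB hs h.2
    rw [abs_neg, abs_mul, abs_of_pos ha] at h1
    rw [abs_neg, abs_mul, abs_of_pos ha'] at h2
    have hu : 0 < |u| := by
      by_contra! h0
      have : |u| = 0 := le_antisymm h0 (abs_nonneg u)
      rw [this] at h1
      linarith
    rcases haa with h3 | h3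
    · rw [div_le_div_iff₀ hB ha] at h3
      nlinarith
    · rw [div_le_div_iff₀ hB ha'] at h3
      nlinarith
  have : ∀ u, (weightTransform (filterWeight ψ a b) u *
      (starRingEnd ℂ) (weightTransform (filterWeight ψ a' b') u)).re * f u = 0 := by
    intro u
    rw [weightTransform_filterWeight _ ha, weightTransform_filterWeight _ ha']
    rcases key u with h | h <;> simp [h]
  simp only [this, integral_zero]

/-! ### Decay and limits of the covariances of a level -/

/-- A continuous function of bounded variation vanishing off `(-A, A)` has `L¹` modulus of
continuity at most `V h`, where `V` is its total variation. -/
lemma exists_integral_shift_le {F : ℝ → ℂ} (hF : Continuous F) {A : ℝ} (hA : 0 < A)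
    (hF0 : ∀ x, F x ≠ 0 → |x| < A) (hbv : BoundedVariationOn F (Set.Icc (-A) A)) :
    ∃ V : ℝ, 0 ≤ V ∧ ∀ h : ℝ, 0 ≤ h → ∫ x, ‖F (x + h) - F x‖ ≤ h * V := by
  have hAA : -A ≤ A := by linarith
  set s := Set.Icc (-A) A with hs
  have hAs : -A ∈ s := Set.left_mem_Icc.2 hAA
  -- The variation function of `F` from `-A`, extended to the line by constants, dominates the
  -- increments of `F`, and integrals of increments of a monotone function telescope.
  set κ : ℝ → ℝ := fun x => (Set.projIcc (-A) A hAA x : ℝ) with hκ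
  have hκs : ∀ x, κ x ∈ s := fun x => (Set.projIcc (-A) A hAA x).2
  have hκmono : Monotone κ := fun x y hxy => Set.monotone_projIcc hAA hxy
  have hFz : ∀ x, A ≤ |x| → F x = 0 := fun x hx => by
    by_contra h; exact absurd (hF0 x h) (not_lt.2 hx)
  have hFκ : ∀ x, F (κ x) = F x := by
    intro x
    rcases le_or_gt x (-A) with h1 | h1
    · rw [hκ]; simp only
      rw [Set.projIcc_of_le_left hAA h1, hFz _ (by simp [abs_of_pos hA]),
        hFz x (by rw [abs_of_nonpos (by linarith)]; linarith)]
    rcases le_or_gt A x with h2 | h2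
    · rw [hκ]; simp only
      rw [Set.projIcc_of_right_le hAA h2, hFz _ (by simp [abs_of_pos hA]),
        hFz x (by rw [abs_of_nonneg (by linarith)]; linarith)]
    · rw [hκ]; simp only
      rw [Set.projIcc_of_mem hAA ⟨h1.le, h2.le⟩]
  set v : ℝ → ℝ := fun x => variationOnFromTo F s (-A) (κ x) with hv
  have hl := hbv.locallyBoundedVariationOn
  have hvmono : Monotone v := fun x y hxy =>
    variationOnFromTo.monotoneOn hl hAs (hκs x) (hκs y) (hκmono hxy)
  have hv0 : ∀ x, 0 ≤ v x := fun x =>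
    variationOnFromTo.nonneg_of_le F s (hκs x).1
  set V := (eVariationOn F s).toReal with hV
  have hvV : ∀ x, v x ≤ V := fun x => by
    have := variationOnFromTo.abs_le_eVariationOn hbv (a := -A) (b := κ x)
    exact (le_abs_self _).trans this
  have hle : ∀ x y, x ≤ y → ‖F y - F x‖ ≤ v y - v x := by
    intro x y hxy
    have h1 : v y - v x = variationOnFromTo F s (κ x) (κ y) := by
      have := variationOnFromTo.add hl hAs (hκs x) (hκs y)
      simp only [hv]
      linarith
    rw [h1, variationOnFromTo.eq_of_le F s (hκmono hxy), ← hFκ x, ← hFκ y, ← dist_eq_norm]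
    exact (hbv.mono Set.inter_subset_left).dist_le ⟨hκs y, hκmono hxy, le_rfl⟩
      ⟨hκs x, le_rfl, hκmono hxy⟩
  refine ⟨V, ENNReal.toReal_nonneg, fun h hh => ?_⟩
  have hvi : ∀ a b, IntervalIntegrable v volume a b := fun a b => hvmono.intervalIntegrable
  have hvi' : IntervalIntegrable (fun x => v (x + h)) volume (-A - h) A :=
    (hvmono.comp fun x y hxy => add_le_add_left hxy h).intervalIntegrable
  have hle' : -A - h ≤ A := by linarith
  calc ∫ x, ‖F (x + h) - F x‖ = ∫ x in (-A - h)..A, ‖F (x + h) - F x‖ := by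
        rw [intervalIntegral.integral_of_le hle', ← integral_indicator measurableSet_Ioc]
        refine integral_congr_ae (.of_forall fun x => ?_)
        by_cases hx : x ∈ Set.Ioc (-A - h) A
        · simp only [Set.indicator_of_mem hx]
        · simp only [Set.indicator_of_notMem hx]
          simp only [Set.mem_Ioc, not_and_or, not_lt, not_le] at hx
          have h1 : F (x + h) = 0 ∧ F x = 0 := by
            rcases hx with hx | hx
            · exact ⟨hFz _ (by rw [abs_of_nonpos (by linarith)]; linarith),
                hFz _ (by rw [abs_of_nonpos (by linarith)]; linarith)⟩
            · exact ⟨hFz _ (by rw [abs_of_nonneg (by linarith)]; linarith),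
                hFz _ (by rw [abs_of_nonneg (by linarith)]; linarith)⟩
          simp [h1]
    _ ≤ ∫ x in (-A - h)..A, (v (x + h) - v x) := by
        refine intervalIntegral.integral_mono_on hle'
          (Continuous.intervalIntegrable (by fun_prop) _ _) ?_ fun x _ => hle _ _ (by linarith)
        exact hvi'.sub (hvi _ _)
    _ = (∫ x in A..(A + h), v x) - ∫ x in (-A - h)..(-A), v x := by
        rw [intervalIntegral.integral_sub hvi' (hvi _ _),
          intervalIntegral.integral_comp_add_right, sub_add_cancel,
          ← intervalIntegral.integral_add_adjacent_intervals (hvi (-A) A) (hvi A (A + h)),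
          ← intervalIntegral.integral_add_adjacent_intervals (hvi (-A - h) (-A)) (hvi (-A) A)]
        ring
    _ ≤ h * V := by
        have h1 : ∫ x in A..(A + h), v x ≤ ∫ x in A..(A + h), V :=
          intervalIntegral.integral_mono_on (by linarith) (hvi _ _) (by simp) fun x _ => hvV x
        have h2 : 0 ≤ ∫ x in (-A - h)..(-A), v x :=
          intervalIntegral.integral_nonneg (by linarith) fun x _ => hv0 x
        rw [intervalIntegral.integral_const, add_sub_cancel_left, smul_eq_mul] at h1
        linarith

/-- Decay of a cosine transform from the `L¹` modulus of continuity at the half period: a shift by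
`π / w` changes the sign of the cosine. -/
lemma abs_integral_mul_cos_le {G : ℝ → ℝ} (hG : Integrable G) {w D : ℝ} (hw : 0 < w)
    (hD : ∫ x, |G (x + Real.pi / w) - G x| ≤ Real.pi / w * D) :
    |∫ x, G x * Real.cos (x * w)| ≤ Real.pi / w * D := by
  have hGc : ∀ G' : ℝ → ℝ, Integrable G' → Integrable fun x => G' x * Real.cos (x * w) :=
    fun G' h => h.mul_bdd (c := 1) (by fun_prop) (.of_forall fun x => Real.abs_cos_le_one _)
  set I := ∫ x, G x * Real.cos (x * w) with hI
  have h1 : I = -∫ x, G (x + Real.pi / w) * Real.cos (x * w) := by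
    rw [hI, ← integral_add_right_eq_self (fun x => G x * Real.cos (x * w)) (Real.pi / w),
      ← integral_neg]
    refine integral_congr_ae (.of_forall fun x => ?_)
    have : (x + Real.pi / w) * w = x * w + Real.pi := by field_simp
    simp only [this, Real.cos_add_pi]
    ring
  have h2 : 2 * I = -∫ x, (G (x + Real.pi / w) - G x) * Real.cos (x * w) := by
    simp_rw [sub_mul]
    rw [integral_sub (hGc _ (hG.comp_add_right _)) (hGc _ hG), ← hI]
    linarith
  have h3 : |2 * I| ≤ Real.pi / w * D := by
    rw [h2, abs_neg]
    refine (abs_integral_le_integral_abs).trans (le_trans ?_ hD)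
    refine integral_mono (hGc _ ((hG.comp_add_right _).sub hG)).abs
      ((hG.comp_add_right _).sub hG).abs fun x => ?_
    simp only [abs_mul]
    exact mul_le_of_le_one_right (abs_nonneg _) (Real.abs_cos_le_one _)
  rw [abs_mul, abs_two] at h3
  linarith [abs_nonneg I]

/-- The regularity of the transform of the filter used throughout: continuity, a bound `K`,
vanishing off `(-A, A)` and bounded variation. -/
structure IsBandLimited (F : ℝ → ℂ) (A K : ℝ) : Prop where
  continuous : Continuous F
  A_pos : 0 < A
  abs_lt : ∀ x, F x ≠ 0 → |x| < A
  norm_le : ∀ x, ‖F x‖ ≤ K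
  bv : BoundedVariationOn F (Set.Icc (-A) A)

/-- An integrable function that on `[-δ, δ]` is bounded by `C` and Lipschitz continuous with
constant `L`. Away from `[-δ, δ]` it may have singularities. -/
structure IsRegularNearZero (f : ℝ → ℝ) (δ C L : ℝ) : Prop where
  integrable : Integrable f
  δ_pos : 0 < δ
  bound : ∀ x, |x| ≤ δ → |f x| ≤ C
  lipschitz : ∀ x y, |x| ≤ δ → |y| ≤ δ → |f x - f y| ≤ L * |x - y|

section

variable {F : ℝ → ℂ} {A K : ℝ} {f : ℝ → ℝ} {δ C L : ℝ}

lemma IsBandLimited.eq_zero (hF : IsBandLimited F A K) {x : ℝ} (hx : A ≤ |x|) : F x = 0 := by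
  by_contra h; exact absurd (hF.abs_lt x h) (not_lt.2 hx)

lemma IsBandLimited.K_nonneg (hF : IsBandLimited F A K) : 0 ≤ K :=
  (norm_nonneg _).trans (hF.norm_le 0)

lemma IsRegularNearZero.C_nonneg (hf : IsRegularNearZero f δ C L) : 0 ≤ C :=
  (abs_nonneg _).trans (hf.bound 0 (by simpa using hf.δ_pos.le))

lemma IsRegularNearZero.L_nonneg (hf : IsRegularNearZero f δ C L) : 0 ≤ L := by
  have h := (abs_nonneg _).trans (hf.lipschitz δ 0 (abs_of_pos hf.δ_pos).le
    (by simpa using hf.δ_pos.le))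
  rw [sub_zero, abs_of_pos hf.δ_pos] at h
  exact nonneg_of_mul_nonneg_left h hf.δ_pos

lemma IsBandLimited.integrable_sq_mul (hF : IsBandLimited F A K) (hf : Integrable f) {σ : ℝ}
    (hσ : 0 < σ) : Integrable fun η => ‖F η‖ ^ 2 * f (σ * η) := by
  refine (hf.comp_mul_left' hσ.ne').bdd_mul (c := K ^ 2)
    ((hF.continuous.norm.pow 2).aestronglyMeasurable) (.of_forall fun x => ?_)
  rw [norm_pow, norm_norm]
  exact pow_le_pow_left₀ (norm_nonneg _) (hF.norm_le x) 2

lemma IsBandLimited.norm_le_indicator (hF : IsBandLimited F A K) (hf : IsRegularNearZero f δ C L)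
    {σ : ℝ} (hσ : 0 < σ) (hσA : σ * A ≤ δ) (x : ℝ) :
    ‖F x‖ ^ 2 * |f (σ * x)| ≤ (Set.Icc (-A) A).indicator (fun _ => K ^ 2 * C) x := by
  by_cases hx : x ∈ Set.Icc (-A) A
  · rw [Set.indicator_of_mem hx]
    have h1 : |σ * x| ≤ δ := by
      rw [abs_mul, abs_of_pos hσ]
      exact (mul_le_mul_of_nonneg_left (abs_le.2 hx) hσ.le).trans hσA
    exact mul_le_mul (pow_le_pow_left₀ (norm_nonneg _) (hF.norm_le x) 2) (hf.bound _ h1)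
      (abs_nonneg _) (by positivity)
  · rw [Set.indicator_of_notMem hx, hF.eq_zero]
    · simp
    · by_contra! h
      exact hx (abs_le.1 h.le)

lemma integrable_indicator_Icc (A c : ℝ) :
    Integrable ((Set.Icc (-A) A).indicator fun _ => c) :=
  (integrable_indicator_iff measurableSet_Icc).2 (integrableOn_const (by simp))

lemma integral_indicator_Icc {A : ℝ} (hA : 0 < A) (c : ℝ) :
    ∫ x, (Set.Icc (-A) A).indicator (fun _ => c) x = 2 * A * c := by
  rw [integral_indicator measurableSet_Icc, setIntegral_const, Real.volume_real_Icc_of_le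
    (by linarith), smul_eq_mul]
  ring

/-- The covariances of one level decay like `1 / |k|`, uniformly in small scales and in shifts
bounded below; this is where bounded variation of the filter's transform enters. -/
lemma exists_levelCov_bound (hF : IsBandLimited F A K) (hf : IsRegularNearZero f δ C L) {θ₀ : ℝ}
    (hθ₀ : 0 < θ₀) : ∃ c₀ : ℝ, 0 ≤ c₀ ∧ ∀ σ θ : ℝ, 0 < σ → σ ≤ 1 → σ * A ≤ δ → θ₀ ≤ θ → ∀ k : ℤ,
      |levelCov F f σ θ k| ≤ c₀ / (1 + |(k : ℝ)|) := by
  obtain ⟨V, hV0, hV⟩ := exists_integral_shift_le hF.continuous hF.A_pos hF.abs_lt hF.bv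
  have hK := hF.K_nonneg
  have hC := hf.C_nonneg
  have hL := hf.L_nonneg
  have hA := hF.A_pos
  set D := 2 * K * C * V + 2 * A * (K ^ 2 * L) with hD
  have hD0 : 0 ≤ D := by positivity
  set c₀ := 2 * A * (K ^ 2 * C) + 2 * (Real.pi / θ₀ * D) with hc₀
  have hpi := Real.pi_pos
  refine ⟨c₀, by positivity, fun σ θ hσ hσ1 hσA hθ k => ?_⟩
  have hbase : |levelCov F f σ θ k| ≤ 2 * A * (K ^ 2 * C) := by
    rw [← integral_indicator_Icc hA, levelCov]
    refine norm_integral_le_of_norm_le (G := ℝ) (integrable_indicator_Icc A _)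
      (.of_forall fun x => ?_)
    refine le_trans ?_ (hF.norm_le_indicator hf hσ hσA x)
    rw [Real.norm_eq_abs, abs_mul, abs_mul, abs_of_nonneg (by positivity : 0 ≤ ‖F x‖ ^ 2)]
    gcongr
    exact mul_le_of_le_one_right (by positivity) (Real.abs_cos_le_one _)
  rcases eq_or_ne k 0 with rfl | hk
  · simp only [Int.cast_zero, abs_zero, add_zero, div_one]
    have : 0 ≤ 2 * (Real.pi / θ₀ * D) := by positivity
    linarith
  have hk1 : (1 : ℝ) ≤ |(k : ℝ)| := by
    rw [← Int.cast_abs]; exact_mod_cast Int.one_le_abs hk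
  have hθp : 0 < θ := hθ₀.trans_le hθ
  set G : ℝ → ℝ := fun η => ‖F η‖ ^ 2 * f (σ * η) with hG
  set w := θ * |(k : ℝ)| with hw
  have hwp : 0 < w := by positivity
  have hGi : Integrable G := hF.integrable_sq_mul hf.integrable hσ
  have hFi : ∀ h : ℝ, Integrable fun x => ‖F (x + h) - F x‖ := by
    intro h
    have hc : HasCompactSupport F := HasCompactSupport.of_support_subset_isCompact
      (isCompact_Icc (a := -A) (b := A)) fun x hx => abs_le.1 (hF.abs_lt x hx).le
    have hi : Integrable F := hF.continuous.integrable_of_hasCompactSupport hc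
    exact ((hi.comp_add_right h).sub hi).norm
  -- The increments of `G` split into those of `|F|²` and, where `F` does not vanish, those of the
  -- density; `f` is regular only near zero, so the cases `|x| > A` and `|x + h| > A` are separate.
  have hpt : ∀ h : ℝ, 0 ≤ h → ∀ x, |G (x + h) - G x| ≤ 2 * K * C * ‖F (x + h) - F x‖ +
      (Set.Icc (-A) A).indicator (fun _ => K ^ 2 * L * h) x := by
    intro h hh x
    have hsq : ∀ x y, |‖F x‖ ^ 2 - ‖F y‖ ^ 2| ≤ 2 * K * ‖F x - F y‖ := by
      intro x y
      rw [sq_sub_sq, abs_mul, abs_of_nonneg (by positivity)]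
      have h1 := hF.norm_le x
      have h2 := hF.norm_le y
      exact mul_le_mul (by linarith) (abs_norm_sub_norm_le _ _) (abs_nonneg _) (by positivity)
    have hσx : ∀ y, |y| ≤ A → |σ * y| ≤ δ := fun y hy => by
      rw [abs_mul, abs_of_pos hσ]
      exact (mul_le_mul_of_nonneg_left hy hσ.le).trans hσA
    have hind : 0 ≤ (Set.Icc (-A) A).indicator (fun _ => K ^ 2 * L * h) x :=
      Set.indicator_nonneg (fun _ _ => by positivity) _
    by_cases h1 : |x + h| ≤ A
    · by_cases h2 : |x| ≤ A
      · rw [Set.indicator_of_mem (show x ∈ Set.Icc (-A) A from abs_le.1 h2)]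
        have e : G (x + h) - G x = (‖F (x + h)‖ ^ 2 - ‖F x‖ ^ 2) * f (σ * (x + h)) +
          ‖F x‖ ^ 2 * (f (σ * (x + h)) - f (σ * x)) := by simp only [hG]; ring
        rw [e]
        refine (abs_add_le _ _).trans (add_le_add ?_ ?_)
        · rw [abs_mul]
          calc _ ≤ 2 * K * ‖F (x + h) - F x‖ * C :=
                mul_le_mul (hsq _ _) (hf.bound _ (hσx _ h1)) (abs_nonneg _) (by positivity)
            _ = _ := by ring
        · rw [abs_mul, abs_of_nonneg (by positivity : 0 ≤ ‖F x‖ ^ 2)]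
          have h3 := hf.lipschitz _ _ (hσx _ h1) (hσx _ h2)
          have h4 : |σ * (x + h) - σ * x| ≤ h := by
            rw [← mul_sub, add_sub_cancel_left, abs_mul, abs_of_pos hσ, abs_of_nonneg hh]
            exact mul_le_of_le_one_left hh hσ1
          calc _ ≤ K ^ 2 * (L * h) := by
                gcongr
                · exact hF.norm_le x
                · exact h3.trans (by gcongr)
            _ = _ := by ring
      · have h3 : F x = 0 := hF.eq_zero (not_le.1 h2).le
        have e : G (x + h) - G x = (‖F (x + h)‖ ^ 2 - ‖F x‖ ^ 2) * f (σ * (x + h)) := by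
          simp [hG, h3]
        rw [e, abs_mul]
        calc _ ≤ 2 * K * ‖F (x + h) - F x‖ * C :=
              mul_le_mul (hsq _ _) (hf.bound _ (hσx _ h1)) (abs_nonneg _) (by positivity)
          _ ≤ _ := by linarith
    · have h3 : F (x + h) = 0 := hF.eq_zero (not_le.1 h1).le
      by_cases h2 : |x| ≤ A
      · have e : G (x + h) - G x = (‖F (x + h)‖ ^ 2 - ‖F x‖ ^ 2) * f (σ * x) := by
          simp [hG, h3]
        rw [e, abs_mul]
        calc _ ≤ 2 * K * ‖F (x + h) - F x‖ * C :=
              mul_le_mul (hsq _ _) (hf.bound _ (hσx _ h2)) (abs_nonneg _) (by positivity)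
          _ ≤ _ := by linarith
      · have h4 : F x = 0 := hF.eq_zero (not_le.1 h2).le
        have : G (x + h) - G x = 0 := by simp [hG, h3, h4]
        rw [this, abs_zero]
        positivity
  have hshift : ∫ x, |G (x + Real.pi / w) - G x| ≤ Real.pi / w * D := by
    have hh : 0 ≤ Real.pi / w := by positivity
    calc _ ≤ ∫ x, (2 * K * C * ‖F (x + Real.pi / w) - F x‖ +
          (Set.Icc (-A) A).indicator (fun _ => K ^ 2 * L * (Real.pi / w)) x) :=
          integral_mono ((hGi.comp_add_right _).sub hGi).abs
            (((hFi _).const_mul _).add (integrable_indicator_Icc A _)) (hpt _ hh)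
      _ = 2 * K * C * (∫ x, ‖F (x + Real.pi / w) - F x‖) +
          2 * A * (K ^ 2 * L * (Real.pi / w)) := by
          rw [integral_add ((hFi _).const_mul _) (integrable_indicator_Icc A _),
            integral_const_mul, integral_indicator_Icc hA]
      _ ≤ 2 * K * C * (Real.pi / w * V) + 2 * A * (K ^ 2 * L * (Real.pi / w)) := by
          gcongr
          exact hV _ hh
      _ = Real.pi / w * D := by rw [hD]; ring
  have hlev : levelCov F f σ θ k = ∫ x, G x * Real.cos (x * w) := by
    refine integral_congr_ae (.of_forall fun x => ?_)
    have : Real.cos (x * θ * k) = Real.cos (x * w) := by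
      rw [hw]
      rcases abs_choice (k : ℝ) with h | h <;> rw [h]
      · congr 1; ring
      · rw [← Real.cos_neg]; congr 1; ring
    simp only [this, hG]
    ring
  have h1 := abs_integral_mul_cos_le hGi hwp hshift
  rw [← hlev] at h1
  refine h1.trans ?_
  rw [le_div_iff₀ (by positivity)]
  have h2 : Real.pi / w ≤ Real.pi / θ₀ / |(k : ℝ)| := by
    rw [div_div, hw]
    gcongr
  calc Real.pi / w * D * (1 + |(k : ℝ)|) ≤ Real.pi / θ₀ / |(k : ℝ)| * D * (2 * |(k : ℝ)|) := by
        gcongr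
        linarith
    _ = 2 * (Real.pi / θ₀ * D) := by
        field_simp
    _ ≤ c₀ := by
        have : 0 ≤ 2 * A * (K ^ 2 * C) := by positivity
        linarith

lemma IsRegularNearZero.tendsto_zero (hf : IsRegularNearZero f δ C L) {x : ℕ → ℝ}
    (hx : Tendsto x atTop (𝓝 0)) : Tendsto (fun j => f (x j)) atTop (𝓝 (f 0)) := by
  rw [tendsto_iff_norm_sub_tendsto_zero]
  have h1 : Tendsto (fun j => L * |x j - 0|) atTop (𝓝 0) := by
    simpa using hx.abs.const_mul L
  refine squeeze_zero' (.of_forall fun _ => norm_nonneg _) ?_ h1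
  have h2 : ∀ᶠ j in atTop, |x j| < δ := by
    have := hx.abs
    rw [abs_zero] at this
    exact this.eventually_lt_const hf.δ_pos
  filter_upwards [h2] with j hj
  exact hf.lipschitz _ _ hj.le (by simpa using hf.δ_pos.le)

lemma tendsto_levelCov (hF : IsBandLimited F A K) (hf : IsRegularNearZero f δ C L) {σ θ : ℕ → ℝ}
    {θ' : ℝ} (hσ0 : ∀ j, 0 < σ j) (hσ : Tendsto σ atTop (𝓝 0)) (hθ : Tendsto θ atTop (𝓝 θ'))
    (k : ℤ) : Tendsto (fun j => levelCov F f (σ j) (θ j) k) atTop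
      (𝓝 (f 0 * ∫ η, ‖F η‖ ^ 2 * Real.cos (η * θ' * k))) := by
  rw [← integral_const_mul]
  have hσA : ∀ᶠ j in atTop, σ j * A ≤ δ := by
    have : Tendsto (fun j => σ j * A) atTop (𝓝 0) := by simpa using hσ.mul_const A
    exact (this.eventually_lt_const hf.δ_pos).mono fun j h => h.le
  refine tendsto_integral_filter_of_dominated_convergence
    ((Set.Icc (-A) A).indicator fun _ => K ^ 2 * C) ?_ ?_ (integrable_indicator_Icc A _) ?_
  · refine .of_forall fun j => ?_
    have h1 := hF.continuous
    exact (Continuous.aestronglyMeasurable (by fun_prop)).mul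
      (hf.integrable.comp_mul_left' (hσ0 j).ne').1
  · filter_upwards [hσA] with j hj
    refine .of_forall fun x => ?_
    refine le_trans ?_ (hF.norm_le_indicator hf (hσ0 j) hj x)
    rw [Real.norm_eq_abs, abs_mul, abs_mul, abs_of_nonneg (by positivity : 0 ≤ ‖F x‖ ^ 2)]
    gcongr
    exact mul_le_of_le_one_right (by positivity) (Real.abs_cos_le_one _)
  · refine .of_forall fun x => ?_
    have h1 : Tendsto (fun j => f (σ j * x)) atTop (𝓝 (f 0)) :=
      hf.tendsto_zero (by simpa using hσ.mul_const x)
    have h2 : Tendsto (fun j => Real.cos (x * θ j * k)) atTop (𝓝 (Real.cos (x * θ' * k))) := by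
      have hc : Continuous fun y : ℝ => Real.cos (x * y * k) := by fun_prop
      exact (hc.tendsto θ').comp hθ
    have := (h2.const_mul (‖F x‖ ^ 2)).mul h1
    simpa [mul_comm] using this

end

/-! ### Cesàro sums and Parseval's identity -/

/-- The number of pairs in `{1, …, n}²` with a given difference. -/
def diffCount (n : ℕ) (d : ℤ) : ℕ :=
  ((Finset.Icc 1 n ×ˢ Finset.Icc 1 n).filter fun p : ℕ × ℕ => (p.1 : ℤ) - p.2 = d).card

lemma diffCount_le (n : ℕ) (d : ℤ) : diffCount n d ≤ n := by
  have h : diffCount n d ≤ (Finset.Icc 1 n).card := by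
    refine Finset.card_le_card_of_injOn Prod.fst (fun p hp => ?_) fun p hp q hq h => ?_
    · simp only [Finset.coe_filter, Finset.mem_product, Set.mem_ofPred_eq] at hp
      exact hp.1.1
    · simp only [Finset.coe_filter, Set.mem_ofPred_eq] at hp hq
      refine Prod.ext h ?_
      have h1 : p.1 = q.1 := h
      have := hp.2
      have := hq.2
      omega
  simpa using h

lemma sub_le_diffCount (n : ℕ) (d : ℤ) : n ≤ diffCount n d + d.natAbs := by
  have h : (Finset.Icc 1 (n - d.natAbs)).card ≤ diffCount n d := by
    refine Finset.card_le_card_of_injOn (fun i => (i + d.toNat, i + (-d).toNat)) (fun i hi => ?_)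
      fun i _ j _ h => ?_
    · simp only [Finset.coe_Icc, Set.mem_Icc] at hi
      simp only [Finset.coe_filter, Finset.mem_product, Finset.mem_Icc, Set.mem_ofPred_eq]
      push_cast
      omega
    · simpa using congrArg Prod.fst h
  rw [Nat.card_Icc] at h
  omega

lemma sum_sub_eq_tsum (n : ℕ) (s : ℤ → ℝ) :
    ∑ k ∈ Finset.Icc 1 n, ∑ l ∈ Finset.Icc 1 n, s ((k : ℤ) - (l : ℤ)) =
      ∑' d : ℤ, (diffCount n d : ℝ) * s d := by
  rw [← Finset.sum_product' (Finset.Icc 1 n) (Finset.Icc 1 n)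
    (fun k l : ℕ => s ((k : ℤ) - (l : ℤ)))]
  rw [← Finset.sum_fiberwise_of_maps_to (t := Finset.Icc (-(n : ℤ)) n)
    (g := fun p : ℕ × ℕ => (p.1 : ℤ) - p.2)]
  · rw [tsum_eq_sum (s := Finset.Icc (-(n : ℤ)) n)]
    · refine Finset.sum_congr rfl fun d _ => ?_
      rw [Finset.sum_congr rfl (g := fun _ => s d)]
      · rw [Finset.sum_const, nsmul_eq_mul, diffCount]
      · intro p hp
        rw [(Finset.mem_filter.1 hp).2]
    · intro d hd
      have : diffCount n d = 0 := by
        rw [diffCount, Finset.card_eq_zero, Finset.filter_eq_empty_iff]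
        intro p hp hpd
        simp only [Finset.mem_product, Finset.mem_Icc] at hp hd
        omega
      simp [this]
  · intro p hp
    simp only [Finset.mem_product, Finset.mem_Icc] at hp ⊢
    omega

/-- Cesàro means of stationary double sums converge to the sum over all lags. -/
lemma tendsto_mean_double_sum {s : ℕ → ℤ → ℝ} {s' g : ℤ → ℝ} {n : ℕ → ℕ}
    (hn : Tendsto n atTop atTop) (hg : Summable g) (hsg : ∀ᶠ j in atTop, ∀ k, |s j k| ≤ g k)
    (hs : ∀ k, Tendsto (fun j => s j k) atTop (𝓝 (s' k))) :
    Tendsto (fun j => (1 / (n j : ℝ)) *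
      ∑ k ∈ Finset.Icc 1 (n j), ∑ l ∈ Finset.Icc 1 (n j), s j ((k : ℤ) - (l : ℤ))) atTop
      (𝓝 (∑' k, s' k)) := by
  simp_rw [sum_sub_eq_tsum, ← tsum_mul_left]
  have hnR : Tendsto (fun j => (n j : ℝ)) atTop atTop := tendsto_natCast_atTop_atTop.comp hn
  refine tendsto_tsum_of_dominated_convergence hg (fun d => ?_) ?_
  · have h1 : Tendsto (fun j => 1 / (n j : ℝ) * diffCount (n j) d) atTop (𝓝 1) := by
      have hlow : Tendsto (fun j => 1 - (d.natAbs : ℝ) / n j) atTop (𝓝 1) := by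
        simpa using (hnR.const_div_atTop (d.natAbs : ℝ)).const_sub 1
      refine tendsto_of_tendsto_of_tendsto_of_le_of_le' hlow tendsto_const_nhds ?_ ?_
      · filter_upwards [hn.eventually_gt_atTop 0] with j hj
        have hj' : (0 : ℝ) < n j := by exact_mod_cast hj
        have : (n j : ℝ) ≤ diffCount (n j) d + d.natAbs := by exact_mod_cast sub_le_diffCount _ _
        rw [one_div_mul_eq_div, le_div_iff₀ hj', sub_mul, div_mul_cancel₀ _ hj'.ne']
        linarith
      · filter_upwards [hn.eventually_gt_atTop 0] with j hj
        have hj' : (0 : ℝ) < n j := by exact_mod_cast hj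
        rw [one_div_mul_eq_div, div_le_one hj']
        exact_mod_cast diffCount_le _ _
    have := h1.mul (hs d)
    simpa [mul_assoc] using this
  · filter_upwards [hsg, hn.eventually_gt_atTop 0] with j hj hj0 d
    have hj' : (0 : ℝ) < n j := by exact_mod_cast hj0
    have h2 : 1 / (n j : ℝ) * diffCount (n j) d ≤ 1 := by
      rw [one_div_mul_eq_div, div_le_one hj']
      exact_mod_cast diffCount_le _ _
    rw [← mul_assoc, norm_mul, Real.norm_of_nonneg (by positivity)]
    exact (mul_le_of_le_one_left (norm_nonneg _) h2).trans (hj d)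

lemma sum_inv_one_add_abs_sub_le {n k : ℕ} (hk : k ∈ Finset.Icc 1 n) :
    ∑ l ∈ Finset.Icc 1 n, 1 / (1 + |(((k : ℤ) - (l : ℤ) : ℤ) : ℝ)|) ≤ 2 * (1 + Real.log n) := by
  have hharm : ∑ i ∈ Finset.range n, 1 / (1 + (i : ℝ)) ≤ 1 + Real.log n := by
    have := harmonic_le_one_add_log n
    simpa [harmonic, add_comm] using this
  simp only [Finset.mem_Icc] at hk
  rw [← Finset.sum_filter_add_sum_filter_not _ (fun l => l ≤ k)]
  have h1 : ∑ l ∈ (Finset.Icc 1 n).filter (fun l => l ≤ k),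
      1 / (1 + |(((k : ℤ) - (l : ℤ) : ℤ) : ℝ)|) ≤ ∑ i ∈ Finset.range n, 1 / (1 + (i : ℝ)) := by
    calc _ = ∑ l ∈ (Finset.Icc 1 n).filter (fun l => l ≤ k), 1 / (1 + ((k - l : ℕ) : ℝ)) := by
          refine Finset.sum_congr rfl fun l hl => ?_
          have hl' := (Finset.mem_filter.1 hl).2
          rw [Nat.cast_sub hl']
          push_cast
          rw [abs_of_nonneg]
          exact sub_nonneg.2 (by exact_mod_cast hl')
      _ = ∑ i ∈ ((Finset.Icc 1 n).filter (fun l => l ≤ k)).image (fun l => k - l),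
          1 / (1 + (i : ℝ)) := by
          rw [Finset.sum_image]
          intro x hx y hy hxy
          simp only [Finset.coe_filter, Set.mem_ofPred_eq] at hx hy
          simp only at hxy
          omega
      _ ≤ _ := by
          refine Finset.sum_le_sum_of_subset_of_nonneg (fun i hi => ?_) fun _ _ _ => by positivity
          simp only [Finset.mem_image, Finset.mem_filter, Finset.mem_Icc] at hi
          obtain ⟨l, hl, rfl⟩ := hi
          simp only [Finset.mem_range]
          omega
  have h2 : ∑ l ∈ (Finset.Icc 1 n).filter (fun l => ¬ l ≤ k),
      1 / (1 + |(((k : ℤ) - (l : ℤ) : ℤ) : ℝ)|) ≤ ∑ i ∈ Finset.range n, 1 / (1 + (i : ℝ)) := by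
    calc _ = ∑ l ∈ (Finset.Icc 1 n).filter (fun l => ¬ l ≤ k), 1 / (1 + ((l - k : ℕ) : ℝ)) := by
          refine Finset.sum_congr rfl fun l hl => ?_
          have hl' := (not_le.1 (Finset.mem_filter.1 hl).2).le
          rw [Nat.cast_sub hl']
          push_cast
          rw [abs_of_nonpos, neg_sub]
          exact sub_nonpos.2 (by exact_mod_cast hl')
      _ = ∑ i ∈ ((Finset.Icc 1 n).filter (fun l => ¬ l ≤ k)).image (fun l => l - k),
          1 / (1 + (i : ℝ)) := by
          rw [Finset.sum_image]
          intro x hx y hy hxy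
          simp only [Finset.coe_filter, Set.mem_ofPred_eq] at hx hy
          simp only at hxy
          omega
      _ ≤ _ := by
          refine Finset.sum_le_sum_of_subset_of_nonneg (fun i hi => ?_) fun _ _ _ => by positivity
          simp only [Finset.mem_image, Finset.mem_filter, Finset.mem_Icc] at hi
          obtain ⟨l, hl, rfl⟩ := hi
          simp only [Finset.mem_range]
          omega
  linarith

/-- The order of the row sums of the weighted covariance matrix of `n` coefficients. -/
lemma tendsto_one_add_log_div_sqrt :
    Tendsto (fun n : ℕ => (1 + Real.log n) / √(n : ℝ)) atTop (𝓝 0) := by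
  have h1 : Tendsto (fun x : ℝ => 1 / √x) atTop (𝓝 0) := by
    simp only [one_div]
    exact Real.tendsto_sqrt_atTop.inv_tendsto_atTop
  have h2 : Tendsto (fun x : ℝ => Real.log x / √x) atTop (𝓝 0) := by
    simp_rw [Real.sqrt_eq_rpow]
    exact (isLittleO_log_rpow_atTop (by norm_num)).tendsto_div_nhds_zero
  have h3 := (h1.add h2).comp (tendsto_natCast_atTop_atTop (R := ℝ))
  simpa [Function.comp_def, add_div] using h3

lemma summable_sq_div_one_add_abs (c : ℝ) :
    Summable fun k : ℤ => (c / (1 + |(k : ℝ)|)) ^ 2 := by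
  have h : Summable fun n : ℕ => (c / (1 + (n : ℝ))) ^ 2 := by
    have h1 := (summable_nat_add_iff 1).2 (Real.summable_one_div_nat_pow.2 one_lt_two)
    refine (h1.mul_left (c ^ 2)).congr fun n => ?_
    push_cast
    rw [div_pow, add_comm (1 : ℝ)]
    ring
  refine Summable.of_nat_of_neg ?_ ?_ <;> simpa using h

/-- Parseval's identity for the periodization of `|F|²` with period `2cπ`. -/
lemma hasSum_sq_integral_cos {F : ℝ → ℂ} {A K : ℝ} (hF : IsBandLimited F A K)
    (heven : ∀ x, ‖F (-x)‖ = ‖F x‖) {c : ℝ} (hc : 0 < c) :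
    HasSum (fun k : ℤ => (∫ η, ‖F η‖ ^ 2 * Real.cos (η * c⁻¹ * k)) ^ 2)
      (2 * c * Real.pi * ∫ η in (-(c * Real.pi))..(c * Real.pi),
        (∑' n : ℤ, ‖F (η + 2 * n * c * Real.pi)‖ ^ 2) ^ 2) := by
  set q := c * Real.pi with hq
  have hqp : 0 < q := by positivity
  have hFc := hF.continuous
  have hab : -q < q := by linarith
  -- On `[-q, q]` only the translates with `|n| ≤ N` contribute to the periodization.
  obtain ⟨N, hN⟩ := exists_nat_gt (A / q)
  rw [div_lt_iff₀ hqp] at hN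
  set G : ℝ → ℝ := fun x => ∑ i ∈ Finset.range (2 * N + 1), ‖F (x + ((i : ℝ) - N) * (2 * q))‖ ^ 2
    with hG
  have hGc : Continuous G := by fun_prop
  have htsum : ∀ x ∈ Set.Icc (-q) q, (∑' n : ℤ, ‖F (x + 2 * n * c * Real.pi)‖ ^ 2) = G x := by
    intro x hx
    rw [tsum_eq_sum (s := (Finset.range (2 * N + 1)).image fun i : ℕ => (i : ℤ) - N)]
    · rw [Finset.sum_image (by intro x _ y _ h; simpa using h)]
      refine Finset.sum_congr rfl fun i _ => ?_
      congr 3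
      push_cast
      rw [hq]; ring
    · intro n hn
      have hn' : (N : ℤ) + 1 ≤ n ∨ n ≤ -(N : ℤ) - 1 := by
        by_contra! h
        refine hn (Finset.mem_image.2 ⟨(n + N).toNat, ?_, ?_⟩)
        · simp only [Finset.mem_range]; omega
        · omega
      rw [hF.eq_zero, norm_zero, zero_pow two_ne_zero]
      have e : 2 * (n : ℝ) * c * Real.pi = n * (2 * q) := by rw [hq]; ring
      rw [e]
      rcases hn' with h | h
      · have h' : (N : ℝ) + 1 ≤ n := by exact_mod_cast h
        refine le_trans ?_ (le_abs_self _)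
        nlinarith [hx.1]
      · have h' : (n : ℝ) ≤ -(N : ℝ) - 1 := by exact_mod_cast h
        refine le_trans ?_ (neg_le_abs _)
        nlinarith [hx.2]
  have hL2 : MemLp (fun x => (G x : ℂ)) 2 (volume.restrict (Set.Ioc (-q) q)) := by
    refine MemLp.of_bound (Continuous.aestronglyMeasurable (by fun_prop))
      ((2 * N + 1 : ℕ) * K ^ 2) (.of_forall fun x => ?_)
    rw [Complex.norm_real, Real.norm_of_nonneg (Finset.sum_nonneg fun _ _ => by positivity)]
    calc G x ≤ ∑ i ∈ Finset.range (2 * N + 1), K ^ 2 :=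
          Finset.sum_le_sum fun i _ => pow_le_pow_left₀ (norm_nonneg _) (hF.norm_le _) 2
      _ = _ := by simp
  have hpars := hasSum_sq_fourierCoeffOn hab hL2
  have hcoef : ∀ k : ℤ, ‖fourierCoeffOn hab (fun x => (G x : ℂ)) k‖ ^ 2 =
      (2 * q)⁻¹ ^ 2 * (∫ η, ‖F η‖ ^ 2 * Real.cos (η * c⁻¹ * k)) ^ 2 := by
    intro k
    set e : ℝ → ℂ := fun x => Complex.exp ((-(x * c⁻¹ * k) : ℝ) * Complex.I) with he
    have hec : Continuous e := by fun_prop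
    have heper : ∀ (x : ℝ) (n : ℤ), e (x + n * (2 * q)) = e x := by
      intro x n
      simp only [he]
      rw [Complex.exp_eq_exp_iff_exists_int]
      refine ⟨-(n * k), ?_⟩
      have : (c : ℂ) ≠ 0 := by exact_mod_cast hc.ne'
      rw [hq]
      push_cast
      field_simp
      ring
    have h1 : fourierCoeffOn hab (fun x => (G x : ℂ)) k =
        ((2 * q)⁻¹ : ℝ) * ∫ x in (-q)..q, e x * G x := by
      rw [fourierCoeffOn_eq_integral, Complex.real_smul]
      congr 1
      · congr 1; ring
      · refine intervalIntegral.integral_congr fun x _ => ?_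
        simp only [smul_eq_mul, fourier_coe_apply, he]
        congr 2
        have : (c : ℂ) ≠ 0 := by exact_mod_cast hc.ne'
        have hpi : (Real.pi : ℂ) ≠ 0 := by exact_mod_cast Real.pi_ne_zero
        rw [hq]
        push_cast
        field_simp
        ring
    -- Unfolding: the integrals of the translates over one period add up to the integral over `ℝ`.
    have h2 : ∫ x in (-q)..q, e x * G x = ∫ x, e x * (‖F x‖ ^ 2 : ℝ) := by
      have hi : ∀ a b, IntervalIntegrable (fun x => e x * (‖F x‖ ^ 2 : ℝ)) volume a b :=
        fun a b => Continuous.intervalIntegrable (by fun_prop) _ _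
      set u : ℕ → ℝ := fun i => -q + ((i : ℝ) - N) * (2 * q) with hu
      calc ∫ x in (-q)..q, e x * G x
          = ∫ x in (-q)..q, ∑ i ∈ Finset.range (2 * N + 1),
              e (x + ((i : ℝ) - N) * (2 * q)) * (‖F (x + ((i : ℝ) - N) * (2 * q))‖ ^ 2 : ℝ) := by
            refine intervalIntegral.integral_congr fun x _ => ?_
            simp only [hG]
            push_cast
            rw [Finset.mul_sum]
            refine Finset.sum_congr rfl fun i _ => ?_
            have := heper x ((i : ℤ) - N)
            push_cast at this
            rw [this]
        _ = ∑ i ∈ Finset.range (2 * N + 1), ∫ x in (u i)..(u (i + 1)),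
              e x * (‖F x‖ ^ 2 : ℝ) := by
            rw [intervalIntegral.integral_finsetSum
              fun i _ => Continuous.intervalIntegrable (by fun_prop) _ _]
            refine Finset.sum_congr rfl fun i _ => ?_
            rw [intervalIntegral.integral_comp_add_right
              (fun x => e x * (‖F x‖ ^ 2 : ℝ)) (((i : ℝ) - N) * (2 * q))]
            congr 1
            simp only [hu]
            push_cast
            ring
        _ = ∫ x in (u 0)..(u (2 * N + 1)), e x * (‖F x‖ ^ 2 : ℝ) :=
            intervalIntegral.sum_integral_adjacent_intervals fun i _ => hi _ _
        _ = _ := by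
            refine intervalIntegral.integral_eq_integral_of_support_subset fun x hx => ?_
            have hx0 : F x ≠ 0 := by
              intro h
              exact hx (by simp [h])
            have hxA := abs_lt.1 (hF.abs_lt x hx0)
            simp only [hu, Set.mem_Ioc]
            push_cast
            constructor <;> nlinarith [hxA.1, hxA.2]
    have hpi : Integrable fun x => ‖F x‖ ^ 2 := by
      have hcs : HasCompactSupport fun x => ‖F x‖ ^ 2 :=
        HasCompactSupport.of_support_subset_isCompact
          (isCompact_Icc (a := -A) (b := A)) fun x hx => abs_le.1 (hF.abs_lt x (by
            intro h; exact hx (by simp [h]))).le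
      exact Continuous.integrable_of_hasCompactSupport (by fun_prop) hcs
    have hci : Integrable fun x => ‖F x‖ ^ 2 * Real.cos (x * c⁻¹ * k) :=
      hpi.mul_bdd (c := 1) (by fun_prop) (.of_forall fun x => Real.abs_cos_le_one _)
    have hsi : Integrable fun x => ‖F x‖ ^ 2 * Real.sin (x * c⁻¹ * k) :=
      hpi.mul_bdd (c := 1) (by fun_prop) (.of_forall fun x => Real.abs_sin_le_one _)
    have hsin : ∫ x, ‖F x‖ ^ 2 * Real.sin (x * c⁻¹ * k) = 0 := by
      have h := integral_neg_eq_self (fun x => ‖F x‖ ^ 2 * Real.sin (x * c⁻¹ * k)) volume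
      simp only [heven, neg_mul, Real.sin_neg, mul_neg, integral_neg] at h
      linarith
    have h3 : ∫ x, e x * (‖F x‖ ^ 2 : ℝ) =
        ((∫ η, ‖F η‖ ^ 2 * Real.cos (η * c⁻¹ * k) : ℝ) : ℂ) := by
      have hpt : ∀ x, e x * (‖F x‖ ^ 2 : ℝ) = ((‖F x‖ ^ 2 * Real.cos (x * c⁻¹ * k) : ℝ) : ℂ) -
          ((‖F x‖ ^ 2 * Real.sin (x * c⁻¹ * k) : ℝ) : ℂ) * Complex.I := by
        intro x
        simp only [he]
        rw [Complex.exp_mul_I, ← Complex.ofReal_cos, ← Complex.ofReal_sin, Real.cos_neg,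
          Real.sin_neg]
        push_cast
        ring
      simp_rw [hpt]
      rw [integral_sub hci.ofReal (hsi.ofReal.mul_const _), integral_mul_const,
        integral_complex_ofReal, integral_complex_ofReal, hsin]
      simp
    rw [h1, h2, h3, norm_mul, Complex.norm_real, Complex.norm_real, mul_pow, Real.norm_eq_abs,
      Real.norm_eq_abs, sq_abs, sq_abs]
  simp_rw [hcoef] at hpars
  have h4 := hpars.mul_left ((2 * q) ^ 2)
  have hq2 : 2 * q ≠ 0 := by positivity
  have e1 : ∫ η in (-q)..q, (∑' n : ℤ, ‖F (η + 2 * n * c * Real.pi)‖ ^ 2) ^ 2 =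
      ∫ x in (-q)..q, ‖(G x : ℂ)‖ ^ 2 := by
    refine intervalIntegral.integral_congr fun x hx => ?_
    rw [Set.uIcc_of_le hab.le] at hx
    simp only [htsum x hx, Complex.norm_real, Real.norm_eq_abs, sq_abs]
  rw [e1]
  convert! h4 using 1
  · ext k
    rw [← mul_assoc, ← mul_pow, mul_inv_cancel₀ hq2, one_pow, one_mul]
  · rw [smul_eq_mul, sub_neg_eq_add, ← two_mul, hq]
    field_simp

/-! ### The spectral density near frequency zero -/

/-- The singular factor `(s₀² - x)^{-2α}` is affine in `x` up to `O(x²)` near `0`. -/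
lemma singularFactor_isBigO {s₀ : ℝ} (hs : 1 < s₀) (α : ℝ) :
    (fun x : ℝ => (s₀ ^ 2 - x) ^ (-2 * α) - (s₀ ^ (-4 * α) + 2 * α * s₀ ^ (-4 * α - 2) * x))
      =O[𝓝 0] fun x => x ^ 2 := by
  set g : ℝ → ℝ := fun x => (s₀ ^ 2 - x) ^ (-2 * α) with hg
  set s : Set ℝ := Set.Ioo (-1) 1 with hs'
  have h0s : (0 : ℝ) ∈ s := by simp [hs']
  have hpos : ∀ x ∈ s, 0 < s₀ ^ 2 - x := fun x hx => by
    have : x < 1 := hx.2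
    nlinarith
  have hcd : ContDiffOn ℝ ((2 : ℕ) : WithTop ℕ∞) g s :=
    ContDiffOn.rpow_const_of_ne (by fun_prop) fun x hx => (hpos x hx).ne'
  have hT := taylor_isLittleO (convex_Ioo _ _) h0s hcd
  have hnhds : 𝓝[s] (0 : ℝ) = 𝓝 0 := isOpen_Ioo.nhdsWithin_eq h0s
  have hs2 : (s₀ ^ 2 : ℝ) = s₀ ^ (2 : ℝ) := by norm_cast
  have hs0 : 0 ≤ s₀ := by linarith
  have hder : HasDerivAt g (2 * α * s₀ ^ (-4 * α - 2)) 0 := by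
    have h1 : HasDerivAt (fun x : ℝ => s₀ ^ 2 - x) (-1) 0 := by
      simpa using (hasDerivAt_id' (0 : ℝ)).const_sub (s₀ ^ 2)
    have h2 := h1.rpow_const (p := -2 * α) (Or.inl (hpos 0 h0s).ne')
    convert! h2 using 1
    rw [sub_zero, hs2, ← Real.rpow_mul hs0]
    have : (2 : ℝ) * (-2 * α - 1) = -4 * α - 2 := by ring
    rw [this]
    ring
  have hg0 : g 0 = s₀ ^ (-4 * α) := by
    simp only [hg, sub_zero]
    rw [hs2, ← Real.rpow_mul hs0]
    congr 1; ring
  have hd1 : iteratedDerivWithin 1 g s 0 = 2 * α * s₀ ^ (-4 * α - 2) := by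
    rw [iteratedDerivWithin_one, derivWithin_of_isOpen isOpen_Ioo h0s, hder.deriv]
  rw [hnhds, ← hs'] at hT
  simp only [sub_zero] at hT
  have hquad : (fun x : ℝ => x ^ 2 * (iteratedDerivWithin 2 g s 0 / 2)) =O[𝓝 0] fun x => x ^ 2 := by
    simp_rw [mul_comm _ (iteratedDerivWithin 2 g s 0 / 2)]
    exact Asymptotics.isBigO_const_mul_self _ _ _
  refine (hT.isBigO.add hquad).congr_left fun x => ?_
  rw [taylorWithinEval_succ, taylorWithinEval_succ, taylor_within_zero_eval, hg0]
  simp only [Nat.cast_zero, zero_add, Nat.factorial_zero, Nat.cast_one, mul_one, inv_one, sub_zero,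
    pow_one, one_mul, smul_eq_mul, Nat.factorial_one, Nat.reduceAdd]
  rw [hd1]
  ring

/-- The first four derivatives of `h` vanish at `0`, hence so do the Taylor terms up to order
four. -/
lemma nuisance_isBigO {h : ℝ → ℝ} {s₀ α : ℝ} (hm : IsSemiparametricModel h s₀ α) :
    (fun x : ℝ => h x - 1) =O[𝓝 0] fun x => x ^ 4 := by
  have hT := taylor_isLittleO_univ (x₀ := 0) (n := 4) hm.contDiff
  simp only [sub_zero] at hT
  refine hT.isBigO.congr_left fun x => ?_
  simp only [taylorWithinEval_succ, taylor_within_zero_eval, iteratedDerivWithin_univ, hm.at_zero]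
  rw [hm.deriv_zero 1 (by decide), hm.deriv_zero 2 (by decide), hm.deriv_zero 3 (by decide),
    hm.deriv_zero 4 (by decide)]
  simp

lemma spectralDensity_eq_of_abs_lt {s₀ : ℝ} (hs : 1 < s₀) (h : ℝ → ℝ) (α : ℝ) {x : ℝ}
    (hx : |x| < 1) : spectralDensity h s₀ α x = h x * (s₀ ^ 2 - x ^ 2) ^ (-2 * α) := by
  have h1 : 0 < s₀ ^ 2 - x ^ 2 := by
    have : x ^ 2 < 1 := (sq_lt_one_iff_abs_lt_one x).2 hx
    nlinarith
  rw [spectralDensity, abs_sub_comm, abs_of_pos h1, neg_mul, Real.rpow_neg h1.le, div_eq_mul_inv]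

/-- Second order expansion of the spectral density at frequency zero, with quartic remainder. -/
lemma spectralDensity_isBigO {h : ℝ → ℝ} {s₀ α : ℝ} (hm : IsSemiparametricModel h s₀ α) :
    (fun x : ℝ => spectralDensity h s₀ α x -
      (s₀ ^ (-4 * α) + 2 * α * s₀ ^ (-4 * α - 2) * x ^ 2)) =O[𝓝 0] fun x => x ^ 4 := by
  have hsq : Tendsto (fun x : ℝ => x ^ 2) (𝓝 0) (𝓝 0) := by
    have : Continuous fun x : ℝ => x ^ 2 := by fun_prop
    simpa using this.tendsto 0
  have h1 := (singularFactor_isBigO hm.one_lt_s₀ α).comp_tendsto hsq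
  have h2 : (fun x : ℝ => (h x - 1) * (s₀ ^ 2 - x ^ 2) ^ (-2 * α)) =O[𝓝 0] fun x => x ^ 4 * 1 := by
    refine (nuisance_isBigO hm).mul ?_
    have hc : ContinuousAt (fun x : ℝ => (s₀ ^ 2 - x ^ 2) ^ (-2 * α)) 0 := by
      refine ContinuousAt.rpow_const (by fun_prop) (Or.inl ?_)
      have := hm.one_lt_s₀
      simp only [ne_eq, OfNat.ofNat_ne_zero, not_false_eq_true, zero_pow, sub_zero]
      positivity
    exact hc.tendsto.isBigO_one ℝ
  have h3 : (fun x : ℝ => (s₀ ^ 2 - x ^ 2) ^ (-2 * α) -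
      (s₀ ^ (-4 * α) + 2 * α * s₀ ^ (-4 * α - 2) * x ^ 2)) =O[𝓝 0] fun x => x ^ 4 :=
    h1.congr (fun x => rfl) fun x => by simp only [Function.comp_apply]; ring
  simp only [mul_one] at h2
  refine (h2.add h3).congr' ?_ EventuallyEq.rfl
  have hlt : ∀ᶠ x : ℝ in 𝓝 0, |x| < 1 := by
    have : Continuous fun x : ℝ => |x| := continuous_abs
    exact (this.tendsto' 0 0 abs_zero).eventually_lt_const one_pos
  filter_upwards [hlt] with x hx
  rw [spectralDensity_eq_of_abs_lt hm.one_lt_s₀ h α hx]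
  ring

/-- A neighbourhood `[-δ, δ]` on which the density is regular and its expansion holds with explicit
constants. -/
lemma exists_isRegularNearZero {h : ℝ → ℝ} {s₀ α : ℝ} (hm : IsSemiparametricModel h s₀ α)
    (hf : Integrable (spectralDensity h s₀ α)) :
    ∃ δ C L C' : ℝ, IsRegularNearZero (spectralDensity h s₀ α) δ C L ∧ ∀ x, |x| ≤ δ →
      |spectralDensity h s₀ α x - (s₀ ^ (-4 * α) + 2 * α * s₀ ^ (-4 * α - 2) * x ^ 2)| ≤
        C' * x ^ 4 := by
  set f := spectralDensity h s₀ α with hfd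
  have hlt : ∀ᶠ x : ℝ in 𝓝 0, |x| < 1 :=
    (continuous_abs.tendsto' (0 : ℝ) 0 abs_zero).eventually_lt_const one_pos
  have hcd : ContDiffAt ℝ 1 f 0 := by
    have h1 : ContDiffAt ℝ 1 (fun x => h x * (s₀ ^ 2 - x ^ 2) ^ (-2 * α)) 0 := by
      refine (hm.contDiff.contDiffAt.of_le (by norm_num)).mul
        (ContDiffAt.rpow_const_of_ne (by fun_prop) ?_)
      have := hm.one_lt_s₀
      simp only [ne_eq, OfNat.ofNat_ne_zero, not_false_eq_true, zero_pow, sub_zero]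
      positivity
    refine h1.congr_of_eventuallyEq ?_
    filter_upwards [hlt] with x hx
    exact spectralDensity_eq_of_abs_lt hm.one_lt_s₀ h α hx
  obtain ⟨L, t, ht, hL⟩ := hcd.exists_lipschitzOnWith
  obtain ⟨C', hC'⟩ := (spectralDensity_isBigO hm).bound
  obtain ⟨δ, hδ, hball⟩ := Metric.eventually_nhds_iff.1 (hC'.and ht)
  have hmem : ∀ x, |x| ≤ δ / 2 → dist x 0 < δ := fun x hx => by
    rw [Real.dist_eq, sub_zero]; linarith
  have hlip : ∀ x y, |x| ≤ δ / 2 → |y| ≤ δ / 2 → |f x - f y| ≤ L * |x - y| := fun x y hx hy => by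
    simpa [Real.dist_eq] using
      hL.dist_le_mul x (hball (hmem x hx)).2 y (hball (hmem y hy)).2
  refine ⟨δ / 2, |f 0| + L * (δ / 2), L, C', ⟨hf, by positivity, fun x hx => ?_, hlip⟩,
    fun x hx => ?_⟩
  · have h1 := hlip x 0 hx (by simpa using (by positivity : 0 ≤ δ / 2))
    rw [sub_zero] at h1
    have h2 : (L : ℝ) * |x| ≤ L * (δ / 2) := by gcongr
    calc |f x| = |f 0 + (f x - f 0)| := by ring_nf
      _ ≤ |f 0| + |f x - f 0| := abs_add_le _ _
      _ ≤ _ := by linarith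
  · have := (hball (hmem x hx)).1
    rw [Real.norm_eq_abs, Real.norm_eq_abs, abs_of_nonneg (by positivity : 0 ≤ x ^ 4)] at this
    exact this

/-- Expansion of the variance of the coefficients of one level as the scale tends to infinity. -/
lemma exists_levelCov_zero_expansion {F : ℝ → ℂ} {A K : ℝ} {f : ℝ → ℝ} {δ C L f₀ f₂ C' : ℝ}
    (hF : IsBandLimited F A K) (hf : IsRegularNearZero f δ C L)
    (hexp : ∀ x, |x| ≤ δ → |f x - (f₀ + f₂ * x ^ 2)| ≤ C' * x ^ 4) :
    ∃ D : ℝ, ∀ σ θ : ℝ, 0 < σ → σ * A ≤ δ →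
      |levelCov F f σ θ 0 - (f₀ * ∫ η, ‖F η‖ ^ 2) - f₂ * σ ^ 2 * ∫ η, η ^ 2 * ‖F η‖ ^ 2| ≤
        D * σ ^ 4 := by
  have hA := hF.A_pos
  have hFc := hF.continuous
  have hC' : 0 ≤ C' := by
    have h := (abs_nonneg _).trans (hexp δ (abs_of_pos hf.δ_pos).le)
    exact nonneg_of_mul_nonneg_left h (pow_pos hf.δ_pos 4)
  refine ⟨2 * A * (K ^ 2 * (C' * A ^ 4)), fun σ θ hσ hσA => ?_⟩
  have hcs : ∀ g : ℝ → ℝ, Continuous g → Integrable fun x => g x * ‖F x‖ ^ 2 := fun g hg => by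
    refine Continuous.integrable_of_hasCompactSupport (by fun_prop)
      (HasCompactSupport.of_support_subset_isCompact (isCompact_Icc (a := -A) (b := A))
      fun x hx => abs_le.1 (hF.abs_lt x (by intro h; exact hx (by simp [h]))).le)
  have h0 : Integrable fun x => ‖F x‖ ^ 2 := by simpa using hcs (fun _ => 1) (by fun_prop)
  have h2 := hcs (fun x => x ^ 2) (by fun_prop)
  have h1 := hF.integrable_sq_mul hf.integrable hσ
  have e : levelCov F f σ θ 0 - (f₀ * ∫ η, ‖F η‖ ^ 2) - f₂ * σ ^ 2 * ∫ η, η ^ 2 * ‖F η‖ ^ 2 =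
      ∫ η, ‖F η‖ ^ 2 * (f (σ * η) - (f₀ + f₂ * (σ * η) ^ 2)) := by
    rw [← integral_const_mul, ← integral_const_mul, levelCov]
    simp only [Int.cast_zero, mul_zero, Real.cos_zero, mul_one]
    have h3 : Integrable fun x => ‖F x‖ ^ 2 * f (σ * x) - f₀ * ‖F x‖ ^ 2 := h1.sub (h0.const_mul _)
    rw [← integral_sub h1 (h0.const_mul _), ← integral_sub h3 (h2.const_mul _)]
    refine integral_congr_ae (.of_forall fun x => ?_)
    simp only
    ring
  rw [e]
  have hb : 2 * A * (K ^ 2 * (C' * A ^ 4)) * σ ^ 4 =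
      2 * A * (K ^ 2 * (C' * A ^ 4) * σ ^ 4) := by ring
  rw [hb, ← integral_indicator_Icc hA]
  refine norm_integral_le_of_norm_le (G := ℝ) (integrable_indicator_Icc A _)
    (.of_forall fun x => ?_)
  by_cases hx : x ∈ Set.Icc (-A) A
  · rw [Set.indicator_of_mem hx]
    have hx' : |x| ≤ A := abs_le.2 hx
    have h3 : |σ * x| ≤ δ := by
      rw [abs_mul, abs_of_pos hσ]
      exact (mul_le_mul_of_nonneg_left hx' hσ.le).trans hσA
    have h4 : x ^ 4 ≤ A ^ 4 := by
      have := pow_le_pow_left₀ (abs_nonneg x) hx' 4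
      rwa [Even.pow_abs (by decide)] at this
    rw [norm_mul, norm_pow, norm_norm, Real.norm_eq_abs]
    calc _ ≤ K ^ 2 * (C' * (σ * x) ^ 4) :=
          mul_le_mul (pow_le_pow_left₀ (norm_nonneg _) (hF.norm_le x) 2) (hexp _ h3)
            (abs_nonneg _) (by positivity)
      _ = K ^ 2 * (C' * x ^ 4) * σ ^ 4 := by ring
      _ ≤ _ := by gcongr
  · rw [Set.indicator_of_notMem hx, hF.eq_zero]
    · simp
    · by_contra! h
      exact hx (abs_le.1 h.le)

/-! ### Scales, bias and the three blocks -/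

section Scales

variable {a : ℕ → ℝ} {m : ℕ → ℕ}

lemma scaleGap_pos (ha_pos : ∀ j, 0 < a j) (ha_mono : StrictMono a) (j : ℕ) : 0 < scaleGap a j := by
  have h1 := ha_pos (j + 1)
  have h2 : a (j + 1) < a (j + 2) := ha_mono (by omega)
  rw [scaleGap, sub_pos]
  gcongr

lemma tendsto_inv_sq_scale (ha_top : Tendsto a atTop atTop) :
    Tendsto (fun j => (a j ^ 2)⁻¹) atTop (𝓝 0) :=
  ((tendsto_pow_atTop two_ne_zero).comp ha_top).inv_tendsto_atTop

lemma tendsto_scaleGap (ha_top : Tendsto a atTop atTop) : Tendsto (scaleGap a) atTop (𝓝 0) := by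
  have h := tendsto_inv_sq_scale ha_top
  have := (h.comp (tendsto_add_atTop_nat 1)).sub (h.comp (tendsto_add_atTop_nat 2))
  rw [sub_zero] at this
  exact this

lemma tendsto_sampleSize_div_gap (ha_pos : ∀ j, 0 < a j) (ha_mono : StrictMono a)
    (ha_top : Tendsto a atTop atTop) (hm_pos : ∀ j, 0 < m j) :
    Tendsto (fun j => (m j : ℝ) / scaleGap a j ^ 2) atTop atTop := by
  have h1 : Tendsto (fun j => (scaleGap a j ^ 2)⁻¹) atTop atTop := by
    refine Tendsto.inv_tendsto_nhdsGT_zero (tendsto_nhdsWithin_iff.2 ⟨?_, .of_forall fun j => ?_⟩)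
    · simpa using (tendsto_scaleGap ha_top).pow 2
    · exact pow_pos (scaleGap_pos ha_pos ha_mono j) 2
  refine tendsto_atTop_mono (fun j => ?_) h1
  have : (1 : ℝ) ≤ m j := by exact_mod_cast hm_pos j
  rw [div_eq_mul_inv]
  exact le_mul_of_one_le_left (by positivity) this

lemma tendsto_bigM (ha_pos : ∀ j, 0 < a j) (ha_mono : StrictMono a)
    (ha_top : Tendsto a atTop atTop) (hm_pos : ∀ j, 0 < m j) :
    Tendsto (bigM a m) atTop atTop :=
  tendsto_nat_floor_atTop.comp (tendsto_sampleSize_div_gap ha_pos ha_mono ha_top hm_pos)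

/-- The normalization `√m_j / gap_j` of the increments is asymptotically `√M_j`. -/
lemma tendsto_normalization (ha_pos : ∀ j, 0 < a j) (ha_mono : StrictMono a)
    (ha_top : Tendsto a atTop atTop) (hm_pos : ∀ j, 0 < m j) :
    Tendsto (fun j => √(m j : ℝ) / (scaleGap a j * √(bigM a m j : ℝ))) atTop (𝓝 1) := by
  have h1 := (tendsto_nat_floor_div_atTop (R := ℝ)).comp
    (tendsto_sampleSize_div_gap ha_pos ha_mono ha_top hm_pos)
  have h2 := (Real.continuous_sqrt.tendsto _).comp (h1.inv₀ one_ne_zero)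
  rw [inv_one, Real.sqrt_one] at h2
  refine h2.congr fun j => ?_
  simp only [Function.comp_apply, inv_div]
  rw [Real.sqrt_div' _ (by positivity), Real.sqrt_div' _ (by positivity),
    Real.sqrt_sq (scaleGap_pos ha_pos ha_mono j).le, div_div]
  rfl

lemma tendsto_sqrt_sampleSize_mul_inv_sq
    (hma : Tendsto (fun j => (m j : ℝ) * (a j ^ 4)⁻¹) atTop (𝓝 0)) :
    Tendsto (fun j => √(m j : ℝ) * (a j ^ 2)⁻¹) atTop (𝓝 0) := by
  have h := (Real.continuous_sqrt.tendsto 0).comp hma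
  rw [Real.sqrt_zero] at h
  refine h.congr fun j => ?_
  simp only [Function.comp_apply]
  have : (a j ^ 4)⁻¹ = ((a j ^ 2)⁻¹) ^ 2 := by rw [inv_pow, ← pow_mul]
  rw [Real.sqrt_mul (by positivity), this, Real.sqrt_sq (by positivity)]

/-- Negligibility of the bias of the mean square of one level. -/
lemma tendsto_bias (ha_top : Tendsto a atTop atTop)
    (hma : Tendsto (fun j => (m j : ℝ) * (a j ^ 4)⁻¹) atTop (𝓝 0)) {r : ℕ → ℝ} {c₀ c₂ D : ℝ}
    (hr : ∀ᶠ i in atTop, |r i - c₀ - c₂ * (a i ^ 2)⁻¹| ≤ D * ((a i ^ 2)⁻¹) ^ 2) :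
    Tendsto (fun j => √(m j : ℝ) * (r j - c₀)) atTop (𝓝 0) := by
  have h1 := (tendsto_sqrt_sampleSize_mul_inv_sq hma).const_mul (|c₂| + |D|)
  rw [mul_zero] at h1
  refine squeeze_zero_norm' ?_ h1
  filter_upwards [hr, (tendsto_inv_sq_scale ha_top).eventually_lt_const one_pos] with j hj hj1
  set s := (a j ^ 2)⁻¹ with hs
  have hs0 : 0 ≤ s := by positivity
  have h2 : |r j - c₀| ≤ (|c₂| + |D|) * s := by
    calc |r j - c₀| = |c₂ * s + (r j - c₀ - c₂ * s)| := by ring_nf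
      _ ≤ |c₂ * s| + |r j - c₀ - c₂ * s| := abs_add_le _ _
      _ ≤ |c₂| * s + |D| * s := by
          rw [abs_mul, abs_of_nonneg hs0]
          have : D * s ^ 2 ≤ |D| * s := by
            calc D * s ^ 2 ≤ |D| * s ^ 2 := by gcongr; exact le_abs_self D
              _ ≤ |D| * s := by gcongr; nlinarith
          linarith
      _ = _ := by ring
  rw [norm_mul, Real.norm_of_nonneg (Real.sqrt_nonneg _), Real.norm_eq_abs]
  calc _ ≤ √(m j : ℝ) * ((|c₂| + |D|) * s) := by gcongr
    _ = _ := by ring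

/-- Negligibility of the bias of the normalized increment. -/
lemma tendsto_bias_increment (ha_pos : ∀ j, 0 < a j) (ha_mono : StrictMono a)
    {A B : ℝ} (hB : 0 < B) (hBA : B < A)
    (ha_ratio : ∀ᶠ j in atTop, A / B ≤ a (j + 1) / a j)
    (hma : Tendsto (fun j => (m j : ℝ) * (a j ^ 4)⁻¹) atTop (𝓝 0)) {r : ℕ → ℝ} {c₀ c₂ D : ℝ}
    (hr : ∀ᶠ i in atTop, |r i - c₀ - c₂ * (a i ^ 2)⁻¹| ≤ D * ((a i ^ 2)⁻¹) ^ 2) :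
    Tendsto (fun j => √(m j : ℝ) * ((r (j + 1) - r (j + 2)) / scaleGap a j - c₂)) atTop (𝓝 0) := by
  set q := 1 - (B / A) ^ 2 with hq
  have hA : 0 < A := hB.trans hBA
  have hq0 : 0 < q := by
    have h1 : B / A < 1 := (div_lt_one hA).2 hBA
    have h2 : 0 < B / A := by positivity
    nlinarith
  have h1 := (tendsto_sqrt_sampleSize_mul_inv_sq hma).const_mul (2 * |D| / q)
  rw [mul_zero] at h1
  refine squeeze_zero_norm' ?_ h1
  filter_upwards [(tendsto_add_atTop_nat 1).eventually hr, (tendsto_add_atTop_nat 2).eventually hr,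
    (tendsto_add_atTop_nat 1).eventually ha_ratio] with j h3 h4 h5
  have hgap := scaleGap_pos ha_pos ha_mono j
  have hgapdef : scaleGap a j = (a (j + 1) ^ 2)⁻¹ - (a (j + 2) ^ 2)⁻¹ := rfl
  set s := (a (j + 1) ^ 2)⁻¹ with hs
  set s' := (a (j + 2) ^ 2)⁻¹ with hs'
  have hs0 : 0 < s := by have := ha_pos (j + 1); positivity
  have hs0' : 0 < s' := by have := ha_pos (j + 2); positivity
  have hsle : s ≤ (a j ^ 2)⁻¹ := by
    have h6 := ha_pos j
    have h7 : a j < a (j + 1) := ha_mono (by omega)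
    rw [hs]; gcongr
  -- The growth of the scales keeps the gap comparable with its larger term.
  have hss : s' ≤ (B / A) ^ 2 * s := by
    have h6 := ha_pos (j + 1)
    have h6' := ha_pos (j + 2)
    rw [div_le_div_iff₀ hB h6] at h5
    have h7 : (A * a (j + 1)) ^ 2 ≤ (a (j + 2) * B) ^ 2 := by gcongr
    rw [hs, hs', div_pow, div_mul_eq_mul_div, ← div_eq_mul_inv, div_div, inv_eq_one_div,
      div_le_div_iff₀ (by positivity) (by positivity)]
    nlinarith
  have hqs : q * s ≤ scaleGap a j := by rw [hgapdef, hq]; linarith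
  have hD : ∀ x : ℝ, D * x ^ 2 ≤ |D| * x ^ 2 := fun x => by gcongr; exact le_abs_self D
  have e : (r (j + 1) - r (j + 2)) / scaleGap a j - c₂ =
      ((r (j + 1) - c₀ - c₂ * s) - (r (j + 2) - c₀ - c₂ * s')) / scaleGap a j := by
    rw [eq_div_iff hgap.ne', sub_mul, div_mul_cancel₀ _ hgap.ne', hgapdef]
    ring
  have h8 : |(r (j + 1) - c₀ - c₂ * s) - (r (j + 2) - c₀ - c₂ * s')| ≤ 2 * |D| * s ^ 2 := by
    have h9 : s' ^ 2 ≤ s ^ 2 := by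
      have : s' ≤ s := by linarith
      gcongr
    have h10 : |D| * s' ^ 2 ≤ |D| * s ^ 2 := by gcongr
    refine (abs_sub _ _).trans ?_
    linarith [hD s, hD s']
  rw [e, norm_mul, Real.norm_of_nonneg (Real.sqrt_nonneg _), Real.norm_eq_abs, abs_div,
    abs_of_pos hgap]
  calc √(m j : ℝ) * (|(r (j + 1) - c₀ - c₂ * s) - (r (j + 2) - c₀ - c₂ * s')| / scaleGap a j)
      ≤ √(m j : ℝ) * (2 * |D| * s ^ 2 / (q * s)) := by gcongr
    _ = 2 * |D| / q * (√(m j : ℝ) * s) := by field_simp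
    _ ≤ 2 * |D| / q * (√(m j : ℝ) * (a j ^ 2)⁻¹) := by gcongr

end Scales

section Levels

variable {r : ℕ → ℤ → ℝ} {ρ : ℤ → ℝ} {c₀ : ℝ}

lemma tendsto_mean_sq_levelCov (hb : ∀ᶠ i in atTop, ∀ k, |r i k| ≤ c₀ / (1 + |(k : ℝ)|))
    (hr : ∀ k, Tendsto (fun i => r i k) atTop (𝓝 (ρ k))) {i n : ℕ → ℕ}
    (hi : Tendsto i atTop atTop) (hn : Tendsto n atTop atTop) :
    Tendsto (fun j => (1 / (n j : ℝ)) * ∑ k ∈ Finset.Icc 1 (n j), ∑ l ∈ Finset.Icc 1 (n j),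
      r (i j) ((k : ℤ) - (l : ℤ)) ^ 2) atTop (𝓝 (∑' k, ρ k ^ 2)) := by
  refine tendsto_mean_double_sum (s := fun j k => r (i j) k ^ 2) hn
    (summable_sq_div_one_add_abs c₀) ?_ fun k => ((hr k).comp hi).pow 2
  filter_upwards [hi.eventually hb] with j hj k
  rw [abs_of_nonneg (sq_nonneg _), ← sq_abs]
  exact pow_le_pow_left₀ (abs_nonneg _) (hj k) 2

lemma sum_abs_levelCov_le (hc₀ : 0 ≤ c₀) {s : ℤ → ℝ} (hb : ∀ k, |s k| ≤ c₀ / (1 + |(k : ℝ)|))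
    {n k : ℕ} (hk : k ∈ Finset.Icc 1 n) :
    ∑ l ∈ Finset.Icc 1 n, |s ((k : ℤ) - (l : ℤ))| ≤ 2 * c₀ * (1 + Real.log n) := by
  calc _ ≤ ∑ l ∈ Finset.Icc 1 n, c₀ * (1 / (1 + |(((k : ℤ) - (l : ℤ) : ℤ) : ℝ)|)) :=
        Finset.sum_le_sum fun l _ => by rw [mul_one_div]; exact hb _
    _ = c₀ * ∑ l ∈ Finset.Icc 1 n, 1 / (1 + |(((k : ℤ) - (l : ℤ) : ℤ) : ℝ)|) := by
        rw [Finset.mul_sum]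
    _ ≤ c₀ * (2 * (1 + Real.log n)) := by gcongr; exact sum_inv_one_add_abs_sub_le hk
    _ = _ := by ring

end Levels

/-- The covariance of three mutually uncorrelated blocks of sizes `m, M, M`, with stationary
covariances `r j`, `r (j + 1)`, `r (j + 2)`. -/
def blockCov (r : ℕ → ℤ → ℝ) (j m M : ℕ) :
    Finset.Icc 1 m ⊕ Finset.Icc 1 M ⊕ Finset.Icc 1 M →
      Finset.Icc 1 m ⊕ Finset.Icc 1 M ⊕ Finset.Icc 1 M → ℝ
  | .inl k, .inl l => r j (((k : ℕ) : ℤ) - ((l : ℕ) : ℤ))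
  | .inr (.inl k), .inr (.inl l) => r (j + 1) (((k : ℕ) : ℤ) - ((l : ℕ) : ℤ))
  | .inr (.inr k), .inr (.inr l) => r (j + 2) (((k : ℕ) : ℤ) - ((l : ℕ) : ℤ))
  | _, _ => 0

/-- Central limit theorem for a weighted sum of squares over three mutually uncorrelated stationary
Gaussian blocks of sizes `m_j, M_j, M_j`, with weights of order `m_j^{-1/2}` and `M_j^{-1/2}`. -/
lemma tendsto_charFun_three_blocks {r : ℕ → ℤ → ℝ} {ρ : ℤ → ℝ} {c₀ : ℝ} (hc₀ : 0 ≤ c₀)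
    (hb : ∀ᶠ i in atTop, ∀ k, |r i k| ≤ c₀ / (1 + |(k : ℝ)|))
    (hr : ∀ k, Tendsto (fun i => r i k) atTop (𝓝 (ρ k))) {m M : ℕ → ℕ}
    (hm : Tendsto m atTop atTop) (hM : Tendsto M atTop atTop) {κ : ℕ → ℝ}
    (hκ : Tendsto κ atTop (𝓝 1)) (u v : ℝ)
    (R : ∀ j, Matrix (Finset.Icc 1 (m j) ⊕ Finset.Icc 1 (M j) ⊕ Finset.Icc 1 (M j))
      (Finset.Icc 1 (m j) ⊕ Finset.Icc 1 (M j) ⊕ Finset.Icc 1 (M j)) ℝ)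
    (hR : ∀ j, (R j).PosSemidef)
    (hblock : ∀ᶠ j in atTop, ∀ x y, R j x y = blockCov r j (m j) (M j) x y)
    (w : ∀ j, Finset.Icc 1 (m j) ⊕ Finset.Icc 1 (M j) ⊕ Finset.Icc 1 (M j) → ℝ)
    (hw : ∀ j, w j = Sum.elim (fun _ => u / √(m j : ℝ))
      (Sum.elim (fun _ => v * κ j / √(M j : ℝ)) fun _ => -(v * κ j / √(M j : ℝ)))) :
    Tendsto (fun j => ∫ x, Complex.exp
        ((∑ k, w j k * x k ^ 2 - ∑ k, w j k * R j k k : ℝ) * Complex.I)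
        ∂(multivariateGaussian 0 (R j))) atTop
      (𝓝 (Complex.exp (-((u ^ 2 + 2 * v ^ 2) * ∑' k, ρ k ^ 2 : ℝ)))) := by
  set q : ℕ → ℝ := fun n => (1 + Real.log n) / √(n : ℝ) with hq
  have hq0 : ∀ n, 0 ≤ q n := fun n => by
    have := Real.log_natCast_nonneg n
    positivity
  refine tendsto_charFun_gaussian_quadForm R hR w
    (fun j => 2 * c₀ * (|u| * q (m j) + |v * κ j| * q (M j))) ?_ ?_ (fun j => ?_) _ ?_
  · have h1 := (tendsto_one_add_log_div_sqrt.comp hm).const_mul |u|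
    have h2 := ((hκ.const_mul v).abs).mul (tendsto_one_add_log_div_sqrt.comp hM)
    have h3 := (h1.add h2).const_mul (2 * c₀)
    simpa using h3
  · filter_upwards [hb, (tendsto_add_atTop_nat 1).eventually hb,
      (tendsto_add_atTop_nat 2).eventually hb, hblock] with j hj0 hj1 hj2 hbl x
    have hkey : ∀ (s : ℤ → ℝ) (n k : ℕ) (y : ℝ), (∀ k, |s k| ≤ c₀ / (1 + |(k : ℝ)|)) →
        k ∈ Finset.Icc 1 n → ∑ l ∈ Finset.Icc 1 n, |s ((k : ℤ) - (l : ℤ)) * (y / √(n : ℝ))| ≤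
          2 * c₀ * (|y| * q n) := by
      intro s n k y hs hk
      simp_rw [abs_mul]
      rw [← Finset.sum_mul, abs_div, abs_of_nonneg (Real.sqrt_nonneg _)]
      calc _ ≤ 2 * c₀ * (1 + Real.log n) * (|y| / √(n : ℝ)) := by
            gcongr
            exact sum_abs_levelCov_le hc₀ hs hk
        _ = _ := by rw [hq]; ring
    have hu0 : 0 ≤ |u| * q (m j) := mul_nonneg (abs_nonneg _) (hq0 _)
    have hv0 : 0 ≤ |v * κ j| * q (M j) := mul_nonneg (abs_nonneg _) (hq0 _)
    rcases x with k | k | k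
    · simp only [Fintype.sum_sum_type, hbl, blockCov, hw, Sum.elim_inl, Sum.elim_inr, zero_mul,
        abs_zero, Finset.sum_const_zero, add_zero]
      rw [Finset.sum_coe_sort (Finset.Icc 1 (m j))
        (fun l => |r j (((k : ℕ) : ℤ) - ((l : ℕ) : ℤ)) * (u / √(m j : ℝ))|)]
      refine (hkey (r j) (m j) k u hj0 k.2).trans ?_
      gcongr
      linarith
    · simp only [Fintype.sum_sum_type, hbl, blockCov, hw, Sum.elim_inl, Sum.elim_inr, zero_mul,
        abs_zero, Finset.sum_const_zero, add_zero, zero_add]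
      rw [Finset.sum_coe_sort (Finset.Icc 1 (M j))
        (fun l => |r (j + 1) (((k : ℕ) : ℤ) - ((l : ℕ) : ℤ)) * (v * κ j / √(M j : ℝ))|)]
      refine (hkey (r (j + 1)) (M j) k (v * κ j) hj1 k.2).trans ?_
      gcongr
      linarith
    · simp only [Fintype.sum_sum_type, hbl, blockCov, hw, Sum.elim_inl, Sum.elim_inr, zero_mul,
        abs_zero, Finset.sum_const_zero, zero_add, mul_neg, abs_neg]
      rw [Finset.sum_coe_sort (Finset.Icc 1 (M j))
        (fun l => |r (j + 2) (((k : ℕ) : ℤ) - ((l : ℕ) : ℤ)) * (v * κ j / √(M j : ℝ))|)]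
      refine (hkey (r (j + 2)) (M j) k (v * κ j) hj2 k.2).trans ?_
      gcongr
      linarith
  · have h1 := hq0 (m j)
    have h2 := hq0 (M j)
    positivity
  · have t0 := (tendsto_mean_sq_levelCov hb hr tendsto_id hm).const_mul (u ^ 2)
    have hκ2 := (hκ.pow 2).const_mul (v ^ 2)
    have t1 := hκ2.mul (tendsto_mean_sq_levelCov hb hr (tendsto_add_atTop_nat 1) hM)
    have t2 := hκ2.mul (tendsto_mean_sq_levelCov hb hr (tendsto_add_atTop_nat 2) hM)
    have t3 := (t0.add t1).add t2
    have e : u ^ 2 * ∑' k, ρ k ^ 2 + v ^ 2 * 1 ^ 2 * ∑' k, ρ k ^ 2 + v ^ 2 * 1 ^ 2 * ∑' k, ρ k ^ 2 =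
        (u ^ 2 + 2 * v ^ 2) * ∑' k, ρ k ^ 2 := by ring
    rw [e] at t3
    refine t3.congr' ?_
    filter_upwards [hblock] with j hbl
    have hkey : ∀ (s : ℤ → ℝ) (n : ℕ) (y : ℝ),
        ∑ k : Finset.Icc 1 n, ∑ l : Finset.Icc 1 n,
          y / √(n : ℝ) * (y / √(n : ℝ)) * s (((k : ℕ) : ℤ) - ((l : ℕ) : ℤ)) ^ 2 =
        y ^ 2 * (1 / (n : ℝ) * ∑ k ∈ Finset.Icc 1 n, ∑ l ∈ Finset.Icc 1 n,
          s ((k : ℤ) - (l : ℤ)) ^ 2) := by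
      intro s n y
      have h1 : ∀ k : Finset.Icc 1 n, ∑ l : Finset.Icc 1 n,
          y / √(n : ℝ) * (y / √(n : ℝ)) * s (((k : ℕ) : ℤ) - ((l : ℕ) : ℤ)) ^ 2 =
          ∑ l ∈ Finset.Icc 1 n,
            y / √(n : ℝ) * (y / √(n : ℝ)) * s (((k : ℕ) : ℤ) - ((l : ℕ) : ℤ)) ^ 2 :=
        fun k => Finset.sum_coe_sort (Finset.Icc 1 n)
          (fun l => y / √(n : ℝ) * (y / √(n : ℝ)) * s (((k : ℕ) : ℤ) - ((l : ℕ) : ℤ)) ^ 2)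
      simp_rw [h1]
      rw [Finset.sum_coe_sort (Finset.Icc 1 n) (fun k => ∑ l ∈ Finset.Icc 1 n,
        y / √(n : ℝ) * (y / √(n : ℝ)) * s (((k : ℕ) : ℤ) - ((l : ℕ) : ℤ)) ^ 2)]
      simp_rw [← Finset.mul_sum]
      rw [div_mul_div_comm, Real.mul_self_sqrt (by positivity)]
      ring
    simp only [Fintype.sum_sum_type, hbl, blockCov, hw, Sum.elim_inl, Sum.elim_inr, ne_eq,
      OfNat.ofNat_ne_zero, not_false_eq_true, zero_pow, mul_zero, Finset.sum_const_zero, add_zero,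
      zero_add, neg_mul_neg]
    rw [hkey (r j) (m j) u, hkey (r (j + 1)) (M j) (v * κ j), hkey (r (j + 2)) (M j) (v * κ j)]
    simp only [id_eq, mul_pow]
    ring

/-! ### The statistics and their joint limit -/

/-- The weight functions of the coefficients entering both statistics at index `j`: `m` coefficients
of level `j` and `M` coefficients of each of the levels `j + 1` and `j + 2`. -/
noncomputable def statWeight (ψ : ℝ → ℝ) (a : ℕ → ℝ) (b : ℕ → ℤ → ℝ) (j m M : ℕ) :
    Finset.Icc 1 m ⊕ Finset.Icc 1 M ⊕ Finset.Icc 1 M → ℝ → ℝ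
  | .inl k => filterWeight ψ (a j) (b j (k : ℕ))
  | .inr (.inl k) => filterWeight ψ (a (j + 1)) (b (j + 1) (k : ℕ))
  | .inr (.inr k) => filterWeight ψ (a (j + 2)) (b (j + 2) (k : ℕ))

lemma integrable_statWeight {ψ : ℝ → ℝ} (hψ : Integrable ψ) {a : ℕ → ℝ} (ha_pos : ∀ j, 0 < a j)
    (b : ℕ → ℤ → ℝ) (j m M : ℕ) : ∀ i, Integrable (statWeight ψ a b j m M i)
  | .inl _ => integrable_filterWeight hψ (ha_pos _) _
  | .inr (.inl _) => integrable_filterWeight hψ (ha_pos _) _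
  | .inr (.inr _) => integrable_filterWeight hψ (ha_pos _) _

lemma weightCov_statWeight {ψ f : ℝ → ℝ} (hψ : Integrable ψ) {A B : ℝ} (hB : 0 < B)
    (hs : tsupport (hat ψ) ⊆ {ξ : ℝ | B ≤ |ξ| ∧ |ξ| ≤ A}) {a γ : ℕ → ℝ} (ha_pos : ∀ j, 0 < a j)
    (ha_mono : StrictMono a) {b : ℕ → ℤ → ℝ}
    (hb : ∀ (j : ℕ) (k l : ℤ), b j k - b j l = γ j * ((k : ℝ) - (l : ℝ))) {j : ℕ}
    (h0 : A / B ≤ a (j + 1) / a j) (h1 : A / B ≤ a (j + 2) / a (j + 1)) (m M : ℕ) (x y) :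
    weightCov f (statWeight ψ a b j m M) x y =
      blockCov (fun i => levelCov (hat ψ) f (a i)⁻¹ (γ i / a i)) j m M x y := by
  have h2 : A / B ≤ a (j + 2) / a j := by
    refine h0.trans ?_
    have := ha_pos j
    gcongr
    exact (ha_mono (by omega : j + 1 < j + 2)).le
  have hsame : ∀ i (k l : ℤ), b i k - b i l = γ i * ((k - l : ℤ) : ℝ) := fun i k l => by
    rw [hb]; push_cast; ring
  rcases x with k | k | k <;> rcases y with l | l | l <;>
    simp only [weightCov, Matrix.of_apply, statWeight, blockCov]
  · exact weightCov_same_level (ha_pos _) _ _ _ _ (hsame _ _ _)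
  · exact weightCov_cross_level hψ hB hs (ha_pos _) (ha_pos _) (Or.inl h0) _ _
  · exact weightCov_cross_level hψ hB hs (ha_pos _) (ha_pos _) (Or.inl h2) _ _
  · exact weightCov_cross_level hψ hB hs (ha_pos _) (ha_pos _) (Or.inr h0) _ _
  · exact weightCov_same_level (ha_pos _) _ _ _ _ (hsame _ _ _)
  · exact weightCov_cross_level hψ hB hs (ha_pos _) (ha_pos _) (Or.inl h1) _ _
  · exact weightCov_cross_level hψ hB hs (ha_pos _) (ha_pos _) (Or.inr h2) _ _
  · exact weightCov_cross_level hψ hB hs (ha_pos _) (ha_pos _) (Or.inr h1) _ _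
  · exact weightCov_same_level (ha_pos _) _ _ _ _ (hsame _ _ _)

section Statistics

variable {Ω : Type*} [MeasurableSpace Ω] {P : Measure Ω} [IsProbabilityMeasure P]
  {X : ℝ → Ω → ℝ} {f : ℝ → ℝ} {ψ : ℝ → ℝ} {a : ℕ → ℝ}

lemma aemeasurable_meanSquare (hX : IsStationaryGaussian P X f) (hψ : Integrable ψ)
    (ha_pos : ∀ j, 0 < a j) (b : ℕ → ℤ → ℝ) (j n : ℕ) :
    AEMeasurable (meanSquare ψ X a b j n) P := by
  have h : ∀ k : ℤ, AEMeasurable (filterTransform ψ X a b j k) P := fun k => by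
    have := hX.aemeasurable_integral (integrable_filterWeight hψ (ha_pos j) (b j k))
    refine this.congr (.of_forall fun ω => (filterTransform_eq ψ X a b j k ω).symm)
  exact (Finset.aemeasurable_fun_sum (Finset.Icc 1 n)
    fun k _ => (h (k : ℤ)).pow_const 2).const_mul (1 / (n : ℝ))

lemma aemeasurable_Ybar (hX : IsStationaryGaussian P X f) (hψ : Integrable ψ)
    (ha_pos : ∀ j, 0 < a j) (b : ℕ → ℤ → ℝ) (m : ℕ → ℕ) (s₀ α : ℝ) (j : ℕ) :
    AEMeasurable (Ybar ψ X a b m s₀ α j) P :=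
  ((aemeasurable_meanSquare hX hψ ha_pos b j (m j)).sub_const _).const_mul _

lemma aemeasurable_Zbar (hX : IsStationaryGaussian P X f) (hψ : Integrable ψ)
    (ha_pos : ∀ j, 0 < a j) (b : ℕ → ℤ → ℝ) (m : ℕ → ℕ) (s₀ α : ℝ) (j : ℕ) :
    AEMeasurable (Zbar ψ X a b m s₀ α j) P :=
  ((((aemeasurable_meanSquare hX hψ ha_pos b (j + 1) _).sub
    (aemeasurable_meanSquare hX hψ ha_pos b (j + 2) _)).div_const _).sub_const _).const_mul _

end Statistics

lemma asymptoticVariance_nonneg (ψ : ℝ → ℝ) {c s₀ : ℝ} (hc : 0 < c) (hs : 0 < s₀) (α : ℝ) :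
    0 ≤ asymptoticVariance ψ c s₀ α := by
  have hpi := Real.pi_pos
  refine mul_nonneg (by positivity) (intervalIntegral.integral_nonneg ?_ fun _ _ => sq_nonneg _)
  have : 0 < c * Real.pi := by positivity
  linarith

lemma limitCovariance_quadForm (V : ℝ) (t : Fin 2 → ℝ) :
    t ⬝ᵥ (limitCovariance V).mulVec t = (t 0 ^ 2 + 2 * t 1 ^ 2) * V := by
  simp [limitCovariance, Matrix.mulVec, dotProduct, Fin.sum_univ_two]
  ring

lemma limitCovariance_posSemidef {V : ℝ} (hV : 0 ≤ V) : (limitCovariance V).PosSemidef := by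
  refine Matrix.PosSemidef.of_dotProduct_mulVec_nonneg ?_ fun x => ?_
  · ext i j
    fin_cases i <;> fin_cases j <;> simp [limitCovariance]
  · rw [star_trivial, limitCovariance_quadForm]
    positivity

/-- Linear combinations of the two statistics are a weighted centred quadratic form in the
coefficients, up to deterministic bias terms. -/
lemma linearCombination_eq {Ω : Type*} (ψ : ℝ → ℝ) (X : ℝ → Ω → ℝ) (a : ℕ → ℝ) (b : ℕ → ℤ → ℝ)
    (m : ℕ → ℕ) (s₀ α u v : ℝ) (r : ℕ → ℤ → ℝ) {j : ℕ} (hm : 0 < m j) (hM : 0 < bigM a m j) (ω : Ω)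
    (w : Finset.Icc 1 (m j) ⊕ Finset.Icc 1 (bigM a m j) ⊕ Finset.Icc 1 (bigM a m j) → ℝ)
    (hw : w = Sum.elim (fun _ => u / √(m j : ℝ))
      (Sum.elim
        (fun _ => v * (√(m j : ℝ) / (scaleGap a j * √(bigM a m j : ℝ))) / √(bigM a m j : ℝ))
        fun _ => -(v * (√(m j : ℝ) / (scaleGap a j * √(bigM a m j : ℝ))) / √(bigM a m j : ℝ)))) :
    u * Ybar ψ X a b m s₀ α j ω + v * Zbar ψ X a b m s₀ α j ω =
      (∑ k, w k * (∫ t, statWeight ψ a b j (m j) (bigM a m j) k t * X t ω) ^ 2 -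
        ∑ k, w k * blockCov r j (m j) (bigM a m j) k k) +
      (u * (√(m j : ℝ) * (r j 0 - s₀ ^ (-4 * α) * ∫ η : ℝ, ‖hat ψ η‖ ^ 2)) +
        v * (√(m j : ℝ) * ((r (j + 1) 0 - r (j + 2) 0) / scaleGap a j -
          2 * α * s₀ ^ (-4 * α - 2) * ∫ η : ℝ, η ^ 2 * ‖hat ψ η‖ ^ 2))) := by
  have hsum : ∀ (i n : ℕ), ∑ k : Finset.Icc 1 n,
      (∫ t, filterWeight ψ (a i) (b i (k : ℕ)) t * X t ω) ^ 2 =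
      ∑ k ∈ Finset.Icc 1 n, filterTransform ψ X a b i (k : ℤ) ω ^ 2 := fun i n => by
    simp_rw [filterTransform_eq]
    exact Finset.sum_coe_sort (Finset.Icc 1 n)
      (fun k => (∫ t, filterWeight ψ (a i) (b i (k : ℕ)) t * X t ω) ^ 2)
  simp only [Fintype.sum_sum_type, hw, Sum.elim_inl, Sum.elim_inr, statWeight, blockCov, sub_self,
    ← Finset.mul_sum, hsum, Finset.sum_const, Finset.card_univ, Fintype.card_coe, Nat.card_Icc,
    Nat.add_sub_cancel, nsmul_eq_mul]
  have hm' : (0 : ℝ) < m j := by exact_mod_cast hm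
  have hM' : (0 : ℝ) < bigM a m j := by exact_mod_cast hM
  have e1 : (m j : ℝ) = √(m j : ℝ) * √(m j : ℝ) := (Real.mul_self_sqrt hm'.le).symm
  have e2 : (bigM a m j : ℝ) = √(bigM a m j : ℝ) * √(bigM a m j : ℝ) :=
    (Real.mul_self_sqrt hM'.le).symm
  have hs1 : √(m j : ℝ) ≠ 0 := (Real.sqrt_pos.2 hm').ne'
  have hs2 : √(bigM a m j : ℝ) ≠ 0 := (Real.sqrt_pos.2 hM').ne'
  have hu : u / √(m j : ℝ) = u * √(m j : ℝ) * (1 / (m j : ℝ)) := by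
    rw [mul_one_div, div_eq_div_iff hs1 hm'.ne', mul_assoc, ← e1]
  have hv : v * (√(m j : ℝ) / (scaleGap a j * √(bigM a m j : ℝ))) / √(bigM a m j : ℝ) =
      v * √(m j : ℝ) / scaleGap a j * (1 / (bigM a m j : ℝ)) := by
    rw [mul_div_assoc', div_div, mul_assoc (scaleGap a j), ← e2, mul_one_div, div_div]
  rw [hu, hv]
  simp only [Ybar, Zbar, incrementStat, meanSquare]
  have hmm : (1 / (m j : ℝ)) * (m j : ℝ) = 1 := by field_simp
  have hMM : (1 / (bigM a m j : ℝ)) * (bigM a m j : ℝ) = 1 := by field_simp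
  linear_combination (u * √(m j : ℝ) * r j 0) * hmm +
    (v * √(m j : ℝ) / scaleGap a j * (r (j + 1) 0 - r (j + 2) 0)) * hMM

/-- Convergence of the characteristic functions of linear combinations of the two statistics. -/
theorem tendsto_charFun_statistics {Ω : Type*} [MeasurableSpace Ω] {P : Measure Ω}
    [IsProbabilityMeasure P] {X : ℝ → Ω → ℝ} {h : ℝ → ℝ} {s₀ α : ℝ}
    (hmodel : IsSemiparametricModel h s₀ α)
    (hX : IsStationaryGaussian P X (spectralDensity h s₀ α))
    {ψ : ℝ → ℝ} {A B : ℝ} (hψ : Integrable ψ)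
    (hψ_bv : BoundedVariationOn (hat ψ) (Set.Icc (-A) A)) (hB : 0 < B) (hBA : B < A)
    (hψ_supp : tsupport (hat ψ) ⊆ {ξ : ℝ | B ≤ |ξ| ∧ |ξ| ≤ A})
    {a : ℕ → ℝ} {m : ℕ → ℕ} {b : ℕ → ℤ → ℝ} {γ : ℕ → ℝ} {c : ℝ}
    (ha_pos : ∀ j, 0 < a j) (ha_mono : StrictMono a) (ha_top : Tendsto a atTop atTop)
    (hm_pos : ∀ j, 0 < m j) (hm_top : Tendsto m atTop atTop)
    (hb : ∀ (j : ℕ) (k l : ℤ), b j k - b j l = γ j * ((k : ℝ) - (l : ℝ)))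
    (hc : 0 < c) (haγ : Tendsto (fun j => a j / γ j) atTop (𝓝 c))
    (ha_ratio : ∃ j₀ : ℕ, ∀ j ≥ j₀, A / B ≤ a (j + 1) / a j)
    (hma : Tendsto (fun j => (m j : ℝ) * (a j ^ 4)⁻¹) atTop (𝓝 0)) (u v : ℝ) :
    Tendsto (fun j => ∫ ω, Complex.exp
        ((u * Ybar ψ X a b m s₀ α j ω + v * Zbar ψ X a b m s₀ α j ω : ℝ) * Complex.I) ∂P) atTop
      (𝓝 (Complex.exp (-((u ^ 2 + 2 * v ^ 2) * (asymptoticVariance ψ c s₀ α / 2) : ℝ)))) := by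
  have hs0 : 0 < s₀ := one_pos.trans hmodel.one_lt_s₀
  set f := spectralDensity h s₀ α with hf
  set F := hat ψ with hFdef
  have hF : IsBandLimited F A (∫ t, ‖ψ t‖) :=
    ⟨continuous_hat hψ, hB.trans hBA,
      fun x hx => (mem_annulus_of_ne_zero (continuous_hat hψ) hB hψ_supp hx).2,
      norm_hat_le ψ, hψ_bv⟩
  obtain ⟨δ, C, L, C', hreg, hexp⟩ := exists_isRegularNearZero hmodel hX.density_integrable
  obtain ⟨D, hD⟩ := exists_levelCov_zero_expansion hF hreg hexp
  have hf0 : f 0 = s₀ ^ (-4 * α) := by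
    have := hexp 0 (by simpa using hreg.δ_pos.le)
    simp only [ne_eq, OfNat.ofNat_ne_zero, not_false_eq_true, zero_pow, mul_zero, add_zero] at this
    exact sub_eq_zero.1 (abs_nonpos_iff.1 this)
  -- The covariances of a level, their decay and their limits.
  set r : ℕ → ℤ → ℝ := fun i => levelCov F f (a i)⁻¹ (γ i / a i) with hr
  set ρ : ℤ → ℝ := fun k => f 0 * ∫ η, ‖F η‖ ^ 2 * Real.cos (η * c⁻¹ * k) with hρ
  have hσ : Tendsto (fun i => (a i)⁻¹) atTop (𝓝 0) := ha_top.inv_tendsto_atTop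
  have hθ : Tendsto (fun i => γ i / a i) atTop (𝓝 c⁻¹) := by
    simpa only [inv_div] using haγ.inv₀ hc.ne'
  have hrlim : ∀ k, Tendsto (fun i => r i k) atTop (𝓝 (ρ k)) := fun k =>
    tendsto_levelCov hF hreg (fun i => inv_pos.2 (ha_pos i)) hσ hθ k
  have hσA : ∀ᶠ i in atTop, (a i)⁻¹ * A ≤ δ := by
    have : Tendsto (fun i => (a i)⁻¹ * A) atTop (𝓝 0) := by simpa using hσ.mul_const A
    exact (this.eventually_lt_const hreg.δ_pos).mono fun i h => h.le
  obtain ⟨c₀, hc₀, hbound⟩ := exists_levelCov_bound hF hreg (θ₀ := c⁻¹ / 2) (by positivity)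
  have hrb : ∀ᶠ i in atTop, ∀ k, |r i k| ≤ c₀ / (1 + |(k : ℝ)|) := by
    filter_upwards [hσA, hσ.eventually_lt_const one_pos,
      hθ.eventually_const_lt (show c⁻¹ / 2 < c⁻¹ by have := inv_pos.2 hc; linarith)] with i h1 h2 h3
    exact hbound _ _ (inv_pos.2 (ha_pos i)) h2.le h1 h3.le
  have hsum : ∑' k, ρ k ^ 2 = asymptoticVariance ψ c s₀ α / 2 := by
    have h1 := (hasSum_sq_integral_cos hF (norm_hat_neg ψ) hc).mul_left (f 0 ^ 2)
    have h2 : f 0 ^ 2 = s₀ ^ (-8 * α) := by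
      rw [hf0, ← Real.rpow_natCast, ← Real.rpow_mul hs0.le]
      congr 1
      push_cast
      ring
    simp_rw [hρ, mul_pow]
    rw [h1.tsum_eq, h2, asymptoticVariance]
    ring
  -- The deterministic bias terms.
  have hr0 : ∀ᶠ i in atTop, |r i 0 - (s₀ ^ (-4 * α) * ∫ η, ‖F η‖ ^ 2) -
      (2 * α * s₀ ^ (-4 * α - 2) * ∫ η, η ^ 2 * ‖F η‖ ^ 2) * (a i ^ 2)⁻¹| ≤
        D * ((a i ^ 2)⁻¹) ^ 2 := by
    filter_upwards [hσA] with i hi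
    have := hD (a i)⁻¹ (γ i / a i) (inv_pos.2 (ha_pos i)) hi
    have e1 : ((a i)⁻¹) ^ 2 = (a i ^ 2)⁻¹ := inv_pow _ _
    have e2 : ((a i)⁻¹) ^ 4 = ((a i ^ 2)⁻¹) ^ 2 := by rw [← e1, ← pow_mul]
    rw [e1, e2, mul_right_comm] at this
    exact this
  have hratio : ∀ᶠ j in atTop, A / B ≤ a (j + 1) / a j := eventually_atTop.2 ha_ratio
  have hbias := ((tendsto_bias ha_top hma hr0).const_mul u).add
    ((tendsto_bias_increment ha_pos ha_mono hB hBA hratio hma hr0).const_mul v)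
  rw [mul_zero, mul_zero, add_zero] at hbias
  -- The quadratic form in the Gaussian vector of all coefficients.
  set M := bigM a m with hM
  have hMtop : Tendsto M atTop atTop := tendsto_bigM ha_pos ha_mono ha_top hm_pos
  set R := fun j => weightCov f (statWeight ψ a b j (m j) (M j)) with hRdef
  have hw := integrable_statWeight hψ ha_pos b
  have hblock : ∀ᶠ j in atTop, ∀ x y, R j x y = blockCov r j (m j) (M j) x y := by
    filter_upwards [hratio, (tendsto_add_atTop_nat 1).eventually hratio] with j h0 h1 x y
    exact weightCov_statWeight hψ hB hψ_supp ha_pos ha_mono hb h0 h1 _ _ x y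
  have hclt := tendsto_charFun_three_blocks hc₀ hrb hrlim hm_top hMtop
    (tendsto_normalization ha_pos ha_mono ha_top hm_pos) u v R
    (fun j => weightCov_posSemidef hX.density_integrable hX.density_nonneg (hw j _ _)) hblock
    _ (fun j => rfl)
  rw [hsum] at hclt
  have hbexp : Tendsto (fun j => Complex.exp
      (((u * (√(m j : ℝ) * (r j 0 - s₀ ^ (-4 * α) * ∫ η : ℝ, ‖F η‖ ^ 2)) +
        v * (√(m j : ℝ) * ((r (j + 1) 0 - r (j + 2) 0) / scaleGap a j -
          2 * α * s₀ ^ (-4 * α - 2) * ∫ η : ℝ, η ^ 2 * ‖F η‖ ^ 2)) : ℝ)) * Complex.I)) atTop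
      (𝓝 1) := by
    have hcont : Continuous fun x : ℝ => Complex.exp (x * Complex.I) := by fun_prop
    have := (hcont.tendsto 0).comp hbias
    simpa only [Function.comp_def, Complex.ofReal_zero, zero_mul, Complex.exp_zero] using this
  have hprod := hclt.mul hbexp
  rw [mul_one] at hprod
  refine hprod.congr' ?_
  filter_upwards [hblock, hMtop.eventually_gt_atTop 0] with j hbl hM0
  rw [← hX.map_integral (hw j _ _), integral_map, ← integral_mul_const]
  · refine integral_congr_ae (.of_forall fun ω => ?_)
    simp only
    rw [← Complex.exp_add, ← add_mul, ← Complex.ofReal_add,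
      linearCombination_eq ψ X a b m s₀ α u v r (hm_pos j) hM0 ω _ rfl]
    simp only [hbl]
    rfl
  · exact (PiLp.continuous_toLp 2 _).measurable.comp_aemeasurable
      (aemeasurable_pi_lambda _ fun i => hX.aemeasurable_integral (hw j _ _ i))
  · fun_prop

end CyclicLongMemory

theorem mainTheorem5 {Ω : Type*} [MeasurableSpace Ω] (P : Measure Ω) [IsProbabilityMeasure P]
    -- the process and its spectral density
    (X : ℝ → Ω → ℝ) (h : ℝ → ℝ) (s₀ α : ℝ)
    (hmodel : CyclicLongMemory.IsSemiparametricModel h s₀ α)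
    (hX : CyclicLongMemory.IsStationaryGaussian P X (CyclicLongMemory.spectralDensity h s₀ α))
    -- the filter
    (ψ : ℝ → ℝ) (A B : ℝ) (hψ : Integrable ψ)
    (hψ_bv : BoundedVariationOn (CyclicLongMemory.hat ψ) (Set.Icc (-A) A))
    (hB : 0 < B) (hBA : B < A)
    (hψ_supp : tsupport (CyclicLongMemory.hat ψ) ⊆ {ξ : ℝ | B ≤ |ξ| ∧ |ξ| ≤ A})
    -- the scales, sample sizes and shifts
    (a : ℕ → ℝ) (m : ℕ → ℕ) (b : ℕ → ℤ → ℝ) (γ : ℕ → ℝ) (c : ℝ)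
    (ha_pos : ∀ j, 0 < a j) (ha_mono : StrictMono a) (ha_top : Tendsto a atTop atTop)
    (hm_pos : ∀ j, 0 < m j) (hm_mono : Monotone m) (hm_top : Tendsto m atTop atTop)
    (hγ_pos : ∀ j, 0 < γ j)
    (hb : ∀ (j : ℕ) (k l : ℤ), b j k - b j l = γ j * ((k : ℝ) - (l : ℝ)))
    (hc : 0 < c) (haγ : Tendsto (fun j => a j / γ j) atTop (𝓝 c))
    (hγ_rate : Tendsto (fun j => (m j : ℝ) ^ 2 * a j ^ 8 * (γ j / a j - 1 / c)) atTop (𝓝 0))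
    (ha_ratio : ∃ j₀ : ℕ, ∀ j ≥ j₀, A / B ≤ a (j + 1) / a j)
    (hma : Tendsto (fun j => (m j : ℝ) * (a j ^ 4)⁻¹) atTop (𝓝 0)) :
    TendstoInDistribution
      (fun (j : ℕ) (ω : Ω) => (!₂[CyclicLongMemory.Ybar ψ X a b m s₀ α j ω,
        CyclicLongMemory.Zbar ψ X a b m s₀ α j ω] : EuclideanSpace ℝ (Fin 2)))
      atTop (id : EuclideanSpace ℝ (Fin 2) → EuclideanSpace ℝ (Fin 2)) (fun _ => P)
      (multivariateGaussian 0 (CyclicLongMemory.limitCovariance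
        (CyclicLongMemory.asymptoticVariance ψ c s₀ α))) ∧
    IndepFun (fun x : EuclideanSpace ℝ (Fin 2) => x 0) (fun x : EuclideanSpace ℝ (Fin 2) => x 1)
      (multivariateGaussian 0 (CyclicLongMemory.limitCovariance
        (CyclicLongMemory.asymptoticVariance ψ c s₀ α))) := by
  have hs0 : 0 < s₀ := one_pos.trans hmodel.one_lt_s₀
  set V := CyclicLongMemory.asymptoticVariance ψ c s₀ α with hV
  have hV0 : 0 ≤ V := CyclicLongMemory.asymptoticVariance_nonneg ψ hc hs0 α
  have hpsd := CyclicLongMemory.limitCovariance_posSemidef hV0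
  have hmeas : ∀ j, AEMeasurable (fun ω => (!₂[CyclicLongMemory.Ybar ψ X a b m s₀ α j ω,
      CyclicLongMemory.Zbar ψ X a b m s₀ α j ω] : EuclideanSpace ℝ (Fin 2))) P := by
    intro j
    refine (PiLp.continuous_toLp 2 _).measurable.comp_aemeasurable
      (aemeasurable_pi_lambda _ fun i => ?_)
    fin_cases i
    · exact CyclicLongMemory.aemeasurable_Ybar hX hψ ha_pos b m s₀ α j
    · exact CyclicLongMemory.aemeasurable_Zbar hX hψ ha_pos b m s₀ α j
  refine ⟨⟨hmeas, by fun_prop, ?_⟩, ?_⟩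
  · refine ProbabilityMeasure.tendsto_iff_tendsto_charFun.2 fun t => ?_
    simp only [ProbabilityMeasure.coe_mk, Measure.map_id]
    rw [charFun_multivariateGaussian hpsd, CyclicLongMemory.limitCovariance_quadForm]
    have hlim := CyclicLongMemory.tendsto_charFun_statistics hmodel hX hψ hψ_bv hB hBA hψ_supp
      ha_pos ha_mono ha_top hm_pos hm_top hb hc haγ ha_ratio hma (t 0) (t 1)
    convert! hlim using 2 with j
    · rw [charFun_apply, integral_map (hmeas j) (by fun_prop)]
      refine integral_congr_ae (.of_forall fun ω => ?_)
      simp [PiLp.inner_apply, Fin.sum_univ_two]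
    · rw [inner_zero_right, hV]
      push_cast
      ring_nf
  · refine HasGaussianLaw.indepFun_of_covariance_eq_zero ?_ ?_
    · exact (IsGaussian.hasGaussianLaw_id (μ := multivariateGaussian 0
        (CyclicLongMemory.limitCovariance V))).map_fun
        ((EuclideanSpace.proj 0 : EuclideanSpace ℝ (Fin 2) →L[ℝ] ℝ).prod
          (EuclideanSpace.proj 1))
    · rw [covariance_eval_multivariateGaussian hpsd]
      simp [CyclicLongMemory.limitCovariance]
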